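/- Let $n\ge 3$ be odd. The straight-line standard $n$-musquash is the closed polygonal drawing of the $n$-cycle whose vertices are $n$ points evenly distributed on a circle in the plane and whose edges are the segments joining the pairs of vertices at maximal distance from each other. A drawing $\mathcal T(c)$ of the $n$-cycle $c$ in the plane is called a standard $n$-musquash if it is the image of the straight-line one under a homeomorphism of the sphere $S^2=\mathbb R^2\cup\{\infty\}$. Fix an orientation of the closed curve $\mathcal T(c)$ and label every domain (connected component) of $\mathbb R^2\setminus\mathcal T(c)$ by the rotation (winding) number of $\mathcal T(c)$ around the points of that domain. Let $\gamma$ be a simple curve in the plane with endpoints $A$ and $B$ which does not pass through the vertices of $\mathcal T(c)$ and which meets every edge of $\mathcal T(c)$ in exactly one point, this point being an interior point of $\gamma$ and a proper crossing (so that $\mathcal T(c)\cup\gamma$ is a thrackle drawing). Then $A$ and $B$ lie in domains of $\mathbb R^2\setminus\mathcal T(c)$ whose labels differ by exactly one. -/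

import Mathlib

open Set

noncomputable section

namespace Thrackle

/-- The vertices of the straight-line standard `n`-musquash (`n` odd), in the order in which the
`n`-cycle visits them. They are the `n`-th roots of unity, and the step `n / 2 = (n - 1) / 2`
along the circle joins two of them at the maximal distance from each other. -/
def stdVertex (n : ℕ) (j : ℤ) : ℂ :=
  Complex.exp (2 * Real.pi * Complex.I * (((n / 2 : ℕ) : ℂ) * (j : ℂ) / (n : ℂ)))

/-- The closed polygon formed by the straight-line standard `n`-musquash, parametrized with
period `n`: the vertices are at the integer times, and on `[j, j + 1]` the edge from the vertex
`j` to the vertex `j + 1` is traversed with constant speed. -/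
def stdCurve (n : ℕ) (t : ℝ) : ℂ :=
  AffineMap.lineMap (stdVertex n ⌊t⌋) (stdVertex n (⌊t⌋ + 1)) (Int.fract t)

/-- `T` is (the parametrized closed curve of) a planar drawing of the `n`-cycle, with vertices
`T 0, …, T (n - 1)` and edges `T '' [j, j + 1]`, which is a standard `n`-musquash up to isotopy:
it is the image of the straight-line one under a homeomorphism of the sphere
`S² = ℂ ∪ {∞}`. -/
structure IsStandardMusquash (n : ℕ) (T : ℝ → ℂ) : Prop where
  three_le : 3 ≤ n
  odd : Odd n
  isotopic : ∃ h : OnePoint ℂ ≃ₜ OnePoint ℂ,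
    ∀ t : ℝ, ((T t : ℂ) : OnePoint ℂ) = h ((stdCurve n t : ℂ) : OnePoint ℂ)

/-- The `j`-th edge of the drawing `T`. -/
def edge (T : ℝ → ℂ) (j : ℕ) : Set ℂ := T '' Icc (j : ℝ) ((j : ℝ) + 1)

/-- The plane sets `S` and `E` cross properly at `p`: some local homeomorphism of the plane at `p`
carries them to the two coordinate axes. -/
def ProperCrossing (S E : Set ℂ) (p : ℂ) : Prop :=
  ∃ φ : OpenPartialHomeomorph ℂ ℂ, p ∈ φ.source ∧ φ p = 0 ∧
    ∀ z ∈ φ.source, (z ∈ S ↔ (φ z).im = 0) ∧ (z ∈ E ↔ (φ z).re = 0)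

/-- The curve `γ` meets the edge `E` at exactly one point, which is interior to `γ` and is
a proper crossing. -/
def CrossesOnce {A B : ℂ} (γ : Path A B) (E : Set ℂ) : Prop :=
  ∃ t : unitInterval, 0 < t ∧ t < 1 ∧ range γ ∩ E = {γ t} ∧ ProperCrossing (range γ) E (γ t)

/-- The closed curve `T : [0, L] → ℂ` does not pass through `p`, and its rotation (winding) number
around `p` is `k`: a continuous choice of the angle of `T t - p` changes by `2πk`. -/
def HasRotationNumber (T : ℝ → ℂ) (L : ℝ) (p : ℂ) (k : ℤ) : Prop :=
  p ∉ T '' Icc 0 L ∧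
    ∃ θ : ℝ → ℝ, ContinuousOn θ (Icc 0 L) ∧
      (∀ t ∈ Icc 0 L, T t - p = (‖T t - p‖ : ℂ) * Complex.exp ((θ t : ℂ) * Complex.I)) ∧
      θ L - θ 0 = 2 * Real.pi * (k : ℝ)

/-- `D` is one of the domains, the connected components of the complement of the drawing `T`
of the `n`-cycle, and its label, the rotation number of `T` around the points of `D`, is `k`. -/
def IsDomainWithLabel (n : ℕ) (T : ℝ → ℂ) (D : Set ℂ) (k : ℤ) : Prop :=
  (∃ x ∈ (T '' Icc 0 (n : ℝ))ᶜ, D = connectedComponentIn (T '' Icc 0 (n : ℝ))ᶜ x) ∧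
    ∀ p ∈ D, HasRotationNumber T n p k

end Thrackle

end

/-!
The rotation number of the drawing changes under a homeomorphism of the sphere only in a mild way:
the difference of the rotation numbers around two points is the rotation number around `0` after a
Möbius transformation that moves the two points to `0` and `∞`, and a homeomorphism of the
punctured plane multiplies all rotation numbers around `0` by its degree, which is `1` or `-1`
(`exists_sign_of_homeo`, `abs_index_sub_eq`). So the curve `γ` may be moved back to the
straight-line musquash, where it becomes a curve on the sphere that changes, exactly once for
every chord, the side of the chord (`ProperCrossing.flip`).

For a point `p` of the disc let `cutSet n p` be the set of the chords that separate it from the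
centre. With `n = 2k + 1`, the label of `p` is `k - #(cutSet n p)` (`hasWinding_disc`), and points
outside the disc have the label `0`. Label the chords by `ZMod n` in the order in which the
musquash runs through them. No point of the disc is cut off by two consecutive chords, so cut sets
are independent sets of edges of the `n`-cycle, and near the circle they have the maximal size `k`.
A part of `γ` within the disc crosses exactly the symmetric difference of the cut sets at its two
ends. Hence, unless `γ` stays in the disc, the set of all edges is a disjoint union of `I ∆ C`,
`W` and `J ∆ C'`, where `I` and `J` are the cut sets of the ends of `γ`, where `C` and `C'` are
independent of size `k`, and where `W` is a disjoint union of symmetric differences of independent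
sets of size `k`.

It remains to compare `k - #I` with `k - #J`. Weigh the edges by `1` on `C` and by `-1` off `C`.
The total is `-1`, and `I ∆ C` contributes `k - #I`. In a difference `J ∆ C'` the members of `J`
can be matched with neighbours in `C'`; two neighbouring edges have total weight at least `0`,
except for the unique pair of consecutive edges off `C`, which has the weight `-2`. So `W` and
`J ∆ C'` together contribute at least `-(k - #J) - 2`, whence `k - #I ≤ k - #J + 1` (`label_le`).
By symmetry the labels differ by at most one, and they differ since `n` is odd (`label_sub_abs`).
If `γ` stays in the disc, then `I ∆ J` is the set of all `n` edges, which is impossible since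
`#I + #J ≤ 2k`.
-/

noncomputable section

namespace Thrackle

/-! ### Winding of a nonvanishing closed curve -/

/-- The curve `f : ℝ → ℂ`, restricted to `[0, L]`, winds `k` times around the origin: a continuous
logarithm of `f` (which in particular does not vanish) changes by `2πik`. -/
def HasWinding (f : ℝ → ℂ) (L : ℝ) (k : ℤ) : Prop :=
  ∃ g : ℝ → ℂ, Continuous g ∧ (∀ t, f t = Complex.exp (g t)) ∧
    g L - g 0 = k * (2 * Real.pi * Complex.I)

theorem exists_continuous_log {X : Type*} [TopologicalSpace X] [SimplyConnectedSpace X]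
    [LocallyPathConnectedSpace X] {f : X → ℂ} (hf : Continuous f) (h0 : ∀ x, f x ≠ 0) :
    ∃ g : X → ℂ, Continuous g ∧ ∀ x, f x = Complex.exp (g x) := by
  obtain ⟨x₀⟩ : Nonempty X := inferInstance
  obtain ⟨g, ⟨-, hg⟩, -⟩ := Complex.isCoveringMapOn_exp.existsUnique_continuousMap_lifts
    ⟨f, hf⟩ (Complex.exp_log (h0 x₀)) (fun x => h0 x)
  exact ⟨g, g.continuous, fun x => (congrFun hg x).symm⟩

theorem HasWinding.exists {f : ℝ → ℂ} {L : ℝ} (hf : Continuous f) (h0 : ∀ t, f t ≠ 0)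
    (hL : f L = f 0) : ∃ k, HasWinding f L k := by
  obtain ⟨g, hg, hfg⟩ := exists_continuous_log hf h0
  rw [hfg, hfg, Complex.exp_eq_exp_iff_exists_int] at hL
  obtain ⟨k, hk⟩ := hL
  exact ⟨k, g, hg, hfg, by rw [hk]; ring⟩

/-- A continuous function with values in the periods of `exp` is constant. -/
theorem exp_period_const {X : Type*} [TopologicalSpace X] [PreconnectedSpace X] {d : X → ℂ}
    (hd : Continuous d) (h1 : ∀ t, Complex.exp (d t) = 1) (s t : X) : d s = d t := by
  have h2 : ∀ t, ∃ m : ℤ, d t = m * (2 * Real.pi * Complex.I) := fun t =>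
    Complex.exp_eq_one_iff.1 (h1 t)
  choose m hm using h2
  have hpi : (2 * Real.pi * Complex.I : ℂ) ≠ 0 := Complex.two_pi_I_ne_zero
  have hmc : Continuous fun t => (m t : ℝ) := by
    have : (fun t => (m t : ℝ)) = fun t => (d t / (2 * Real.pi * Complex.I)).re := by
      funext t
      rw [hm t, mul_div_cancel_right₀ _ hpi]; simp
    rw [this]
    exact Complex.continuous_re.comp (hd.div_const _)
  have hmc' : Continuous m := Int.isClosedEmbedding_coe_real.isEmbedding.continuous_iff.2 hmc
  rw [hm s, hm t, PreconnectedSpace.constant ‹_› hmc' (x := s) (y := t)]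

theorem HasWinding.unique {f : ℝ → ℂ} {L : ℝ} {k l : ℤ} (hk : HasWinding f L k)
    (hl : HasWinding f L l) : k = l := by
  obtain ⟨g, hg, hfg, hgL⟩ := hk
  obtain ⟨g', hg', hfg', hgL'⟩ := hl
  have := exp_period_const (d := fun t => g t - g' t) (hg.sub hg') (fun t => by
    rw [Complex.exp_sub, ← hfg, ← hfg', div_self]; rw [hfg]; exact Complex.exp_ne_zero _) L 0
  have h2 : (k : ℂ) * (2 * Real.pi * Complex.I) = l * (2 * Real.pi * Complex.I) := by
    rw [← hgL, ← hgL']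
    linear_combination this
  exact_mod_cast mul_right_cancel₀ Complex.two_pi_I_ne_zero h2

theorem HasWinding.mul {f f' : ℝ → ℂ} {L : ℝ} {k l : ℤ} (hk : HasWinding f L k)
    (hl : HasWinding f' L l) : HasWinding (fun t => f t * f' t) L (k + l) := by
  obtain ⟨g, hg, hfg, hgL⟩ := hk
  obtain ⟨g', hg', hfg', hgL'⟩ := hl
  refine ⟨fun t => g t + g' t, hg.add hg', fun t => by simp only [hfg, hfg', Complex.exp_add], ?_⟩
  push_cast
  linear_combination hgL + hgL'

theorem HasWinding.inv {f : ℝ → ℂ} {L : ℝ} {k : ℤ} (hk : HasWinding f L k) :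
    HasWinding (fun t => (f t)⁻¹) L (-k) := by
  obtain ⟨g, hg, hfg, hgL⟩ := hk
  refine ⟨fun t => -g t, hg.neg, fun t => by simp only [hfg, Complex.exp_neg], ?_⟩
  push_cast
  linear_combination -hgL

theorem HasWinding.const {a : ℂ} (ha : a ≠ 0) (L : ℝ) : HasWinding (fun _ => a) L 0 :=
  ⟨fun _ => Complex.log a, continuous_const, fun _ => (Complex.exp_log ha).symm, by simp⟩

/-- A closed curve in the slit plane does not wind around the origin. -/
theorem HasWinding.of_slitPlane {f : ℝ → ℂ} {L : ℝ} (hf : Continuous f)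
    (h : ∀ t, f t ∈ Complex.slitPlane) (hL : f L = f 0) : HasWinding f L 0 :=
  ⟨fun t => Complex.log (f t), hf.clog h,
    fun t => (Complex.exp_log (Complex.slitPlane_ne_zero (h t))).symm, by simp [hL]⟩

/-- Rouché's principle: two closed curves closer to each other than to the origin wind equally. -/
theorem HasWinding.of_norm_sub_lt {f f' : ℝ → ℂ} {L : ℝ} {k : ℤ} (hk : HasWinding f L k)
    (hf : Continuous f) (hf' : Continuous f') (hL : f L = f 0) (hL' : f' L = f' 0)
    (h : ∀ t, ‖f' t - f t‖ < ‖f t‖) : HasWinding f' L k := by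
  have h0 : ∀ t, f t ≠ 0 := fun t => norm_pos_iff.1 ((norm_nonneg _).trans_lt (h t))
  have h1 : HasWinding (fun t => f' t / f t) L 0 := by
    refine HasWinding.of_slitPlane (hf'.div hf h0) (fun t => ?_) (by simp only [hL, hL'])
    have h2 : ‖f' t / f t - 1‖ < 1 := by
      rw [div_sub_one (h0 t), norm_div, div_lt_one (norm_pos_iff.2 (h0 t))]
      exact h t
    left
    have := (abs_lt.1 ((Complex.abs_re_le_norm _).trans_lt h2)).1
    simp only [Complex.sub_re, Complex.one_re] at this
    linarith
  have := hk.mul h1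
  simpa [mul_div_cancel₀, h0] using this

/-- A continuous self-map `u` of the punctured plane multiplies all winding numbers by a constant,
its degree. -/
theorem exists_degree {u : ℂ → ℂ} (hu : ContinuousOn u {0}ᶜ) (h0 : ∀ z ≠ 0, u z ≠ 0) :
    ∃ d : ℤ, ∀ (f : ℝ → ℂ) (L : ℝ) (k : ℤ), HasWinding f L k →
      HasWinding (fun t => u (f t)) L (d * k) := by
  -- `φ` lifts `u` to the universal cover `exp` of the punctured plane
  obtain ⟨φ, hφ, huφ⟩ := exists_continuous_log (f := fun w : ℂ => u (Complex.exp w))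
    (hu.comp_continuous Complex.continuous_exp fun w => Complex.exp_ne_zero w)
    (fun w => h0 _ (Complex.exp_ne_zero w))
  have hper : ∀ w, φ (w + 2 * Real.pi * Complex.I) - φ w =
      φ (0 + 2 * Real.pi * Complex.I) - φ 0 := fun w => by
    refine exp_period_const (d := fun w => φ (w + 2 * Real.pi * Complex.I) - φ w)
      (by fun_prop) (fun w => ?_) w 0
    rw [Complex.exp_sub, ← huφ, ← huφ, Complex.exp_periodic w, div_self]
    exact h0 _ (Complex.exp_ne_zero w)
  obtain ⟨d, hd⟩ : ∃ d : ℤ, φ (0 + 2 * Real.pi * Complex.I) - φ 0 =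
      d * (2 * Real.pi * Complex.I) := by
    rw [← Complex.exp_eq_one_iff, Complex.exp_sub, ← huφ, ← huφ, Complex.exp_periodic 0, div_self]
    exact h0 _ (Complex.exp_ne_zero 0)
  have hmulti : ∀ (k : ℤ) (w : ℂ), φ (w + k * (2 * Real.pi * Complex.I)) - φ w =
      k * (d * (2 * Real.pi * Complex.I)) := by
    intro k
    induction k using Int.induction_on with
    | zero => simp
    | succ i ih =>
      intro w
      have h1 := ih w
      have h2 := hper (w + i * (2 * Real.pi * Complex.I))
      push_cast at h1 ⊢
      rw [show w + (i + 1 : ℂ) * (2 * Real.pi * Complex.I) =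
        w + i * (2 * Real.pi * Complex.I) + 2 * Real.pi * Complex.I by ring]
      linear_combination h1 + h2 + hd
    | pred i ih =>
      intro w
      have h1 := ih w
      have h2 := hper (w + (-i - 1) * (2 * Real.pi * Complex.I))
      push_cast at h1 ⊢
      rw [show w + (-i - 1 : ℂ) * (2 * Real.pi * Complex.I) + 2 * Real.pi * Complex.I =
        w + -i * (2 * Real.pi * Complex.I) by ring] at h2
      linear_combination h1 - h2 - hd
  refine ⟨d, fun f L k hk => ?_⟩
  obtain ⟨g, hg, hfg, hgL⟩ := hk
  refine ⟨fun t => φ (g t), hφ.comp hg, fun t => by simp only [hfg, huφ], ?_⟩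
  have := hmulti k (g 0)
  rw [← hgL, add_sub_cancel] at this
  rw [this]; push_cast; ring

/-- A homeomorphism of the punctured plane preserves all winding numbers or reverses all of
them. -/
theorem exists_sign_of_homeo {u v : ℂ → ℂ} (hu : ContinuousOn u {0}ᶜ) (hv : ContinuousOn v {0}ᶜ)
    (hu0 : ∀ z ≠ 0, u z ≠ 0) (hv0 : ∀ z ≠ 0, v z ≠ 0) (huv : ∀ z ≠ 0, v (u z) = z) :
    ∃ d : ℤ, |d| = 1 ∧ ∀ (f : ℝ → ℂ) (L : ℝ) (k : ℤ), HasWinding f L k →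
      HasWinding (fun t => u (f t)) L (d * k) := by
  obtain ⟨d, hd⟩ := exists_degree hu hu0
  obtain ⟨e, he⟩ := exists_degree hv hv0
  refine ⟨d, ?_, hd⟩
  have h1 : HasWinding (fun t => Complex.exp (t * (2 * Real.pi * Complex.I))) 1 1 :=
    ⟨fun t => t * (2 * Real.pi * Complex.I), by fun_prop, fun t => rfl, by simp⟩
  have h2 := he _ _ _ (hd _ _ _ h1)
  simp only [huv _ (Complex.exp_ne_zero _)] at h2
  have h3 := h2.unique h1
  rw [mul_one, mul_comm] at h3
  exact Int.isUnit_iff_abs_eq.1 (IsUnit.of_mul_eq_one _ h3)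

/-! ### Independent sets of edges of an odd cycle -/

section Combinatorics

open Finset

variable {n k : ℕ}

/-- The set `I` of edges of the `n`-cycle contains no two consecutive edges. -/
def Indep (I : Finset (ZMod n)) : Prop := ∀ j ∈ I, j + 1 ∉ I

/-- The function that is `1` on `D` and `-1` off `D`. -/
def sgn (D : Finset (ZMod n)) (j : ZMod n) : ℤ := if j ∈ D then 1 else -1

theorem sum_sgn_of_mem {D Z : Finset (ZMod n)} (h : ∀ j ∈ Z, j ∈ D) :
    ∑ j ∈ Z, sgn D j = #Z := by
  have h1 : ∀ j ∈ Z, sgn D j = 1 := fun j hj => if_pos (h j hj)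
  simp [Finset.sum_congr rfl h1]

theorem sum_sgn_of_notMem {D Z : Finset (ZMod n)} (h : ∀ j ∈ Z, j ∉ D) :
    ∑ j ∈ Z, sgn D j = -#Z := by
  have h1 : ∀ j ∈ Z, sgn D j = -1 := fun j hj => if_neg (h j hj)
  simp [Finset.sum_congr rfl h1]

theorem card_symmDiff_add (I C : Finset (ZMod n)) :
    ∑ j ∈ symmDiff I C, sgn C j = (#C : ℤ) - #I ∧
      ∃ r, #(symmDiff I C) + 2 * r = #I + #C := by
  have h0 : symmDiff I C = (I \ C) ∪ (C \ I) := rfl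
  have hd : Disjoint (I \ C) (C \ I) := disjoint_sdiff_sdiff
  have hI := Finset.card_sdiff_add_card_inter I C
  have hC := Finset.card_sdiff_add_card_inter C I
  rw [Finset.inter_comm] at hC
  constructor
  · rw [h0, Finset.sum_union hd, sum_sgn_of_notMem fun j hj => (Finset.mem_sdiff.1 hj).2,
      sum_sgn_of_mem fun j hj => (Finset.mem_sdiff.1 hj).1]
    lia
  · refine ⟨#(I ∩ C), ?_⟩
    rw [h0, Finset.card_union_of_disjoint hd]
    lia

variable [NeZero n]

/-- The pairs `j, j + 1` of consecutive edges that belong to `Z` but not to `D`. -/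
def gaps (D Z : Finset (ZMod n)) : Finset (ZMod n) :=
  Finset.univ.filter fun j => j ∈ Z ∧ j + 1 ∈ Z ∧ j ∉ D ∧ j + 1 ∉ D

/-- `Z` is balanced: it is even, and, with respect to every independent set `D` of the maximal
size `k`, its members in `D` are not fewer than its other members, up to the pair of consecutive
edges off `D` (there is only one such pair in the whole cycle). -/
def Balanced (k : ℕ) (Z : Finset (ZMod n)) : Prop :=
  Even #Z ∧ ∀ D : Finset (ZMod n), Indep D → #D = k → -2 * (#(gaps D Z) : ℤ) ≤ ∑ j ∈ Z, sgn D j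

theorem card_gaps_univ (hn : n = 2 * k + 1) {D : Finset (ZMod n)} (hD : Indep D) (hk : #D = k) :
    #(gaps D Finset.univ) = 1 := by
  have h1 : gaps D Finset.univ = (D ∪ D.image (· - 1))ᶜ := by
    ext j
    simp only [gaps, Finset.mem_filter, Finset.mem_univ, true_and, Finset.mem_compl,
      Finset.mem_union, Finset.mem_image, not_or, not_exists, not_and]
    refine and_congr_right fun _ => ⟨fun h a ha hj => h (by rwa [← hj, sub_add_cancel]),
      fun h h' => h _ h' (add_sub_cancel_right _ _)⟩
  have h2 : Disjoint D (D.image (· - 1)) := by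
    rw [Finset.disjoint_left]
    rintro j hj hj'
    obtain ⟨a, ha, rfl⟩ := Finset.mem_image.1 hj'
    exact hD _ hj (by rwa [sub_add_cancel])
  rw [h1, Finset.card_compl, Finset.card_union_of_disjoint h2,
    Finset.card_image_of_injective _ (sub_left_injective), ZMod.card, hk]
  omega

/-- The members of `I` outside `C` are matched with neighbours in `C` outside `I`, all of them
with the next or all of them with the previous edge: only one pair of consecutive edges misses
`C`, and `I` does not contain both of its members. -/
theorem Indep.exists_shift (hn : n = 2 * k + 1) {I C : Finset (ZMod n)} (hI : Indep I)
    (hC : Indep C) (hk : #C = k) :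
    ∃ s : ZMod n, (s = 1 ∨ s = -1) ∧ ∀ j ∈ I \ C, j + s ∈ C \ I := by
  obtain ⟨m, hm⟩ := Finset.card_eq_one.1 (card_gaps_univ hn hC hk)
  have hm' : ∀ j, j ∉ C → j + 1 ∉ C → j = m := fun j h1 h2 => by
    rw [← Finset.mem_singleton, ← hm]; simp [gaps, h1, h2]
  by_cases h : m ∈ I
  · refine ⟨-1, Or.inr rfl, fun j hj => ?_⟩
    rw [Finset.mem_sdiff] at hj ⊢
    have h1 : j + -1 + 1 = j := by ring
    constructor
    · by_contra h2
      have := hm' _ h2 (by rw [h1]; exact hj.2)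
      apply hI m h
      rw [← this, h1]; exact hj.1
    · intro h2
      exact hI _ h2 (by rw [h1]; exact hj.1)
  · refine ⟨1, Or.inl rfl, fun j hj => ?_⟩
    rw [Finset.mem_sdiff] at hj ⊢
    refine ⟨?_, hI _ hj.1⟩
    by_contra h2
    exact h (hm' j hj.2 h2 ▸ hj.1)

theorem sum_sgn_symmDiff_ge (hn : n = 2 * k + 1) {I C : Finset (ZMod n)} (hI : Indep I)
    (hC : Indep C) (hk : #C = k) (D : Finset (ZMod n)) :
    -((k : ℤ) - #I) - 2 * #(gaps D (symmDiff I C)) ≤ ∑ j ∈ symmDiff I C, sgn D j := by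
  obtain ⟨s, hs, hsh⟩ := hI.exists_shift hn hC hk
  have h0 : symmDiff I C = (I \ C) ∪ (C \ I) := rfl
  set M := (I \ C).image (· + s) with hM
  have hMC : M ⊆ C \ I := fun j hj => by
    obtain ⟨a, ha, rfl⟩ := Finset.mem_image.1 hj
    exact hsh a ha
  have hinj : Function.Injective (· + s : ZMod n → ZMod n) := add_left_injective s
  have hcM : #M = #(I \ C) := Finset.card_image_of_injective _ hinj
  have hsum : ∑ j ∈ symmDiff I C, sgn D j =
      ∑ j ∈ I \ C, (sgn D j + sgn D (j + s)) + ∑ j ∈ (C \ I) \ M, sgn D j := by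
    rw [h0, Finset.sum_union disjoint_sdiff_sdiff, ← Finset.sum_sdiff hMC, hM,
      Finset.sum_image (fun _ _ _ _ h => hinj h), Finset.sum_add_distrib]
    ring
  have h1 : -(#((C \ I) \ M) : ℤ) ≤ ∑ j ∈ (C \ I) \ M, sgn D j := by
    have := Finset.card_nsmul_le_sum ((C \ I) \ M) (sgn D) (-1) (fun j _ => by
      unfold sgn; split_ifs <;> norm_num)
    simpa using this
  have h2 : -2 * (#((I \ C).filter fun j => j ∉ D ∧ j + s ∉ D) : ℤ) ≤
      ∑ j ∈ I \ C, (sgn D j + sgn D (j + s)) := by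
    rw [Finset.card_filter]
    push_cast
    rw [Finset.mul_sum]
    refine Finset.sum_le_sum fun j _ => ?_
    unfold sgn
    split_ifs <;> simp_all
  have h3 : #((I \ C).filter fun j => j ∉ D ∧ j + s ∉ D) ≤ #(gaps D (symmDiff I C)) := by
    have hZ : ∀ j ∈ I \ C, j ∈ symmDiff I C ∧ j + s ∈ symmDiff I C := fun j hj =>
      ⟨Finset.mem_union_left _ hj, Finset.mem_union_right _ (hsh j hj)⟩
    rcases hs with rfl | rfl
    · refine Finset.card_le_card fun j hj => ?_
      obtain ⟨hj, h4, h5⟩ := Finset.mem_filter.1 hj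
      simp only [gaps, Finset.mem_filter, Finset.mem_univ, true_and]
      exact ⟨(hZ j hj).1, (hZ j hj).2, h4, h5⟩
    · refine Finset.card_le_card_of_injOn (· + -1) (fun j hj => ?_) (hinj.injOn)
      obtain ⟨hj, h4, h5⟩ := Finset.mem_filter.1 hj
      simp only [gaps, Finset.coe_filter, Finset.mem_univ, true_and, Set.mem_ofPred_eq,
        neg_add_cancel_right]
      exact ⟨(hZ j hj).2, (hZ j hj).1, h5, h4⟩
  have h4 : (#((C \ I) \ M) : ℤ) = k - #I := by
    have ha := Finset.card_sdiff_add_card_eq_card hMC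
    have hI := Finset.card_sdiff_add_card_inter I C
    have hC := Finset.card_sdiff_add_card_inter C I
    rw [Finset.inter_comm] at hC
    lia
  rw [hsum]
  have h3' : (#((I \ C).filter fun j => j ∉ D ∧ j + s ∉ D) : ℤ) ≤ #(gaps D (symmDiff I C)) := by
    exact_mod_cast h3
  linarith

theorem balanced_symmDiff (hn : n = 2 * k + 1) {I C : Finset (ZMod n)} (hI : Indep I)
    (hIk : #I = k) (hC : Indep C) (hk : #C = k) : Balanced k (symmDiff I C) := by
  refine ⟨?_, fun D _ _ => ?_⟩
  · obtain ⟨r, hr⟩ := (card_symmDiff_add I C).2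
    exact ⟨k - r, by lia⟩
  · have := sum_sgn_symmDiff_ge hn hI hC hk D
    rw [hIk] at this
    linarith

theorem balanced_empty : Balanced k (∅ : Finset (ZMod n)) :=
  ⟨by simp, fun D _ _ => by simp⟩

theorem card_gaps_union (D : Finset (ZMod n)) {Z Z' : Finset (ZMod n)} (h : Disjoint Z Z') :
    #(gaps D Z) + #(gaps D Z') ≤ #(gaps D (Z ∪ Z')) := by
  rw [← Finset.card_union_of_disjoint]
  · refine Finset.card_le_card fun j hj => ?_
    simp only [gaps, Finset.mem_union, Finset.mem_filter, Finset.mem_univ, true_and] at hj ⊢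
    tauto
  · rw [Finset.disjoint_left] at h ⊢
    intro j hj hj'
    simp only [gaps, Finset.mem_filter, Finset.mem_univ, true_and] at hj hj'
    exact h hj.1 hj'.1

theorem Balanced.union {Z Z' : Finset (ZMod n)} (hZ : Balanced k Z) (hZ' : Balanced k Z')
    (h : Disjoint Z Z') : Balanced k (Z ∪ Z') := by
  refine ⟨by rw [Finset.card_union_of_disjoint h]; exact hZ.1.add hZ'.1, fun D hD hk => ?_⟩
  have h1 := hZ.2 D hD hk
  have h2 := hZ'.2 D hD hk
  have h3 : (#(gaps D Z) : ℤ) + #(gaps D Z') ≤ #(gaps D (Z ∪ Z')) := by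
    exact_mod_cast card_gaps_union D h
  rw [Finset.sum_union h]
  linarith

/-- One half of the comparison of the labels `k - #I` and `k - #J` of the two ends: weigh every
edge by `sgn C`. The total is `-1`, the first part contributes exactly `k - #I`, and the
other two at least `-(k - #J) - 2`, because the cycle has only one gap of `C`. -/
theorem label_le (hn : n = 2 * k + 1) {I J C C' W : Finset (ZMod n)} (hJ : Indep J)
    (hC : Indep C) (hCk : #C = k) (hC' : Indep C') (hCk' : #C' = k) (hW : Balanced k W)
    (h1 : Disjoint (symmDiff I C) W) (h2 : Disjoint (symmDiff I C ∪ W) (symmDiff J C'))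
    (hu : symmDiff I C ∪ W ∪ symmDiff J C' = Finset.univ) :
    (k : ℤ) - #I ≤ k - #J + 1 := by
  have ht : ∑ j, sgn C j = -1 := by
    rw [← Finset.sum_sdiff (Finset.subset_univ C)]
    rw [sum_sgn_of_notMem fun j hj => (Finset.mem_sdiff.1 hj).2, sum_sgn_of_mem fun j hj => hj]
    have hc := Finset.card_sdiff_add_card_eq_card (Finset.subset_univ C)
    rw [Finset.card_univ, ZMod.card] at hc
    lia
  rw [← hu, Finset.sum_union h2, Finset.sum_union h1, (card_symmDiff_add I C).1] at ht
  have h3 := hW.2 C hC hCk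
  have h4 := sum_sgn_symmDiff_ge hn hJ hC' hCk' C
  have h5 : #(gaps C W) + #(gaps C (symmDiff J C')) ≤ 1 := by
    rw [← card_gaps_univ hn hC hCk]
    refine (card_gaps_union C (h2.mono_left Finset.subset_union_right)).trans ?_
    refine Finset.card_le_card fun j hj => ?_
    simp only [gaps, Finset.mem_filter, Finset.mem_univ, true_and] at hj ⊢
    tauto
  have h5' : (#(gaps C W) : ℤ) + #(gaps C (symmDiff J C')) ≤ 1 := by exact_mod_cast h5
  linarith

theorem label_sub_abs (hn : n = 2 * k + 1) {I J C C' W : Finset (ZMod n)} (hI : Indep I)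
    (hJ : Indep J) (hC : Indep C) (hCk : #C = k) (hC' : Indep C') (hCk' : #C' = k)
    (hW : Balanced k W) (h1 : Disjoint (symmDiff I C) W)
    (h2 : Disjoint (symmDiff I C ∪ W) (symmDiff J C'))
    (hu : symmDiff I C ∪ W ∪ symmDiff J C' = Finset.univ) :
    |((k : ℤ) - #I) - (k - #J)| = 1 := by
  have ha := label_le hn hJ hC hCk hC' hCk' hW h1 h2 hu
  rw [Finset.disjoint_union_left] at h2
  have hb := label_le hn hI hC' hCk' hC hCk hW h2.2.symm
    (Finset.disjoint_union_left.2 ⟨h2.1.symm, h1.symm⟩)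
    (by rw [← hu, Finset.union_comm (symmDiff J C') W, Finset.union_comm,
      Finset.union_assoc])
  have hcard : #(symmDiff I C) + #W + #(symmDiff J C') = n := by
    rw [← Finset.card_union_of_disjoint h1,
      ← Finset.card_union_of_disjoint (Finset.disjoint_union_left.2 h2), hu, Finset.card_univ,
      ZMod.card]
  obtain ⟨r, hr⟩ := (card_symmDiff_add I C).2
  obtain ⟨r', hr'⟩ := (card_symmDiff_add J C').2
  obtain ⟨w, hw⟩ := hW.1
  have : (#I : ℤ) - #J ≠ 0 := by lia
  rcases lt_or_gt_of_ne this with h | h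
  · rw [abs_of_pos] <;> lia
  · rw [abs_of_neg] <;> lia

theorem Indep.two_mul_card_lt (hn : n = 2 * k + 1) {I : Finset (ZMod n)} (hI : Indep I) :
    2 * #I < n := by
  have h2 : Disjoint I (I.image (· - 1)) := by
    rw [Finset.disjoint_left]
    rintro j hj hj'
    obtain ⟨a, ha, rfl⟩ := Finset.mem_image.1 hj'
    exact hI _ hj (by rwa [sub_add_cancel])
  have := Finset.card_le_univ (I ∪ I.image (· - 1))
  rw [Finset.card_union_of_disjoint h2, Finset.card_image_of_injective _ (sub_left_injective),
    ZMod.card] at this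
  lia

theorem Indep.symmDiff_ne_univ (hn : n = 2 * k + 1) {I J : Finset (ZMod n)} (hI : Indep I)
    (hJ : Indep J) : symmDiff I J ≠ Finset.univ := by
  intro h
  obtain ⟨r, hr⟩ := (card_symmDiff_add I J).2
  rw [h, Finset.card_univ, ZMod.card] at hr
  have := hI.two_mul_card_lt hn
  have := hJ.two_mul_card_lt hn
  lia

end Combinatorics

/-! ### The chords of the straight-line musquash -/

/-- The angle by which one step along the straight-line musquash turns around the circle. -/
def stepAngle (n : ℕ) : ℝ := 2 * Real.pi * (n / 2 : ℕ) / n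

/-- The direction of the midpoint of the `j`-th chord. -/
def chordDir (n : ℕ) (j : ℤ) : ℂ := Complex.exp ((stepAngle n * (j + 1 / 2) : ℝ) * Complex.I)

/-- The signed distance of `p` from the line through the `j`-th chord; it is negative on the side
of the centre of the circle. -/
def side (n : ℕ) (j : ℤ) (p : ℂ) : ℝ :=
  (p * (starRingEnd ℂ) (chordDir n j)).re - Real.cos (stepAngle n / 2)

variable {n : ℕ}

theorem stdVertex_eq (n : ℕ) (j : ℤ) :
    stdVertex n j = Complex.exp ((stepAngle n * j : ℝ) * Complex.I) := by
  unfold stdVertex stepAngle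
  congr 1
  push_cast
  ring

theorem norm_stdVertex (n : ℕ) (j : ℤ) : ‖stdVertex n j‖ = 1 := by
  rw [stdVertex_eq, Complex.norm_exp_ofReal_mul_I]

theorem stepAngle_pos (h3 : 3 ≤ n) : 0 < stepAngle n := by
  unfold stepAngle
  have : 0 < n / 2 := by lia
  positivity

theorem stepAngle_lt_pi (h3 : 3 ≤ n) (ho : Odd n) : stepAngle n < Real.pi := by
  obtain ⟨k, hk⟩ := ho
  unfold stepAngle
  have h1 : n / 2 = k := by lia
  have hn : (0 : ℝ) < n := by positivity
  rw [h1, div_lt_iff₀ hn, hk]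
  push_cast
  nlinarith [Real.pi_pos]

theorem cos_half_pos (h3 : 3 ≤ n) (ho : Odd n) : 0 < Real.cos (stepAngle n / 2) :=
  Real.cos_pos_of_mem_Ioo ⟨by linarith [stepAngle_pos h3, Real.pi_pos],
    by linarith [stepAngle_lt_pi h3 ho]⟩

theorem sin_half_pos (h3 : 3 ≤ n) (ho : Odd n) : 0 < Real.sin (stepAngle n / 2) :=
  Real.sin_pos_of_pos_of_lt_pi (by linarith [stepAngle_pos h3])
    (by linarith [stepAngle_lt_pi h3 ho, Real.pi_pos])

theorem chordDir_mul_conj (n : ℕ) (j : ℤ) :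
    chordDir n j * (starRingEnd ℂ) (chordDir n j) = 1 := by
  rw [Complex.mul_conj, Complex.normSq_eq_norm_sq, chordDir, Complex.norm_exp_ofReal_mul_I]
  simp

theorem norm_chordDir (n : ℕ) (j : ℤ) : ‖chordDir n j‖ = 1 := by
  rw [chordDir, Complex.norm_exp_ofReal_mul_I]

theorem stdVertex_eq_chordDir (n : ℕ) (j : ℤ) :
    stdVertex n j = chordDir n j *
      (Real.cos (stepAngle n / 2) - Real.sin (stepAngle n / 2) * Complex.I) := by
  have : (Real.cos (stepAngle n / 2) - Real.sin (stepAngle n / 2) * Complex.I : ℂ) =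
      Complex.exp ((-(stepAngle n / 2) : ℝ) * Complex.I) := by
    rw [Complex.exp_mul_I, ← Complex.ofReal_cos, ← Complex.ofReal_sin, Real.cos_neg, Real.sin_neg]
    push_cast; ring
  rw [this, chordDir, stdVertex_eq, ← Complex.exp_add]
  congr 1
  push_cast; ring

theorem stdVertex_succ_eq_chordDir (n : ℕ) (j : ℤ) :
    stdVertex n (j + 1) = chordDir n j *
      (Real.cos (stepAngle n / 2) + Real.sin (stepAngle n / 2) * Complex.I) := by
  have : (Real.cos (stepAngle n / 2) + Real.sin (stepAngle n / 2) * Complex.I : ℂ) =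
      Complex.exp ((stepAngle n / 2 : ℝ) * Complex.I) := by
    rw [Complex.exp_mul_I, ← Complex.ofReal_cos, ← Complex.ofReal_sin]
  rw [this, chordDir, stdVertex_eq, ← Complex.exp_add]
  congr 1
  push_cast; ring

/-- The point of the `j`-th chord at the parameter `s` in the coordinates adapted to the chord. -/
theorem lineMap_stdVertex (n : ℕ) (j : ℤ) (s : ℝ) :
    AffineMap.lineMap (stdVertex n j) (stdVertex n (j + 1)) s = chordDir n j *
      (Real.cos (stepAngle n / 2) +
        ((2 * s - 1) * Real.sin (stepAngle n / 2) : ℝ) * Complex.I) := by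
  rw [AffineMap.lineMap_apply, stdVertex_succ_eq_chordDir, stdVertex_eq_chordDir]
  simp only [vsub_eq_sub, vadd_eq_add, Complex.real_smul]
  push_cast; ring

theorem stdCurve_eq_lineMap (n : ℕ) (j : ℤ) {t : ℝ} (ht : t ∈ Icc (j : ℝ) (j + 1)) :
    stdCurve n t = AffineMap.lineMap (stdVertex n j) (stdVertex n (j + 1)) (t - j) := by
  rcases ht.2.eq_or_lt with h | h
  · have h1 : ⌊t⌋ = j + 1 := by rw [h]; exact_mod_cast Int.floor_intCast (R := ℝ) (j + 1)
    have h2 : Int.fract t = 0 := by rw [Int.fract, h1, h]; push_cast; ring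
    rw [stdCurve, h1, h2, h]
    simp
  · have h1 : ⌊t⌋ = j := Int.floor_eq_iff.2 ⟨ht.1, h⟩
    rw [stdCurve, Int.fract, h1]

theorem stdCurve_eq (n : ℕ) (j : ℤ) {t : ℝ} (ht : t ∈ Icc (j : ℝ) (j + 1)) :
    stdCurve n t = chordDir n j * (Real.cos (stepAngle n / 2) +
      ((2 * (t - j) - 1) * Real.sin (stepAngle n / 2) : ℝ) * Complex.I) := by
  rw [stdCurve_eq_lineMap n j ht, lineMap_stdVertex]

theorem stdCurve_intCast (n : ℕ) (j : ℤ) : stdCurve n j = stdVertex n j := by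
  simp [stdCurve]

theorem continuous_stdCurve (n : ℕ) : Continuous (stdCurve n) := by
  have hlf : LocallyFinite fun j : ℤ => Icc (j : ℝ) (j + 1) := by
    intro x
    refine ⟨Ioo (x - 1) (x + 1), Ioo_mem_nhds (by linarith) (by linarith), ?_⟩
    refine (Set.finite_Icc (⌊x⌋ - 3) (⌊x⌋ + 3)).subset ?_
    rintro j ⟨y, hy, hy'⟩
    have h1 := Int.floor_le x
    have h2 := Int.lt_floor_add_one x
    constructor
    · have : ((⌊x⌋ - 3 : ℤ) : ℝ) ≤ j := by push_cast; linarith [hy.2, hy'.1]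
      exact_mod_cast this
    · have : (j : ℝ) ≤ ((⌊x⌋ + 3 : ℤ) : ℝ) := by push_cast; linarith [hy.1, hy'.2]
      exact_mod_cast this
  refine hlf.continuous (Set.iUnion_eq_univ_iff.2 fun x =>
    ⟨⌊x⌋, Int.floor_le x, (Int.lt_floor_add_one x).le⟩) (fun j => isClosed_Icc) (fun j => ?_)
  refine ContinuousOn.congr (f := fun t : ℝ =>
    AffineMap.lineMap (k := ℝ) (stdVertex n j) (stdVertex n (j + 1)) (t - j)) ?_
    fun t ht => stdCurve_eq_lineMap n j ht
  exact Continuous.continuousOn (by fun_prop)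

theorem stepAngle_mul (h3 : 3 ≤ n) : stepAngle n * n = 2 * Real.pi * (n / 2 : ℕ) := by
  have : (n : ℝ) ≠ 0 := by positivity
  unfold stepAngle
  field_simp

theorem stdVertex_add_period (h3 : 3 ≤ n) (j m : ℤ) :
    stdVertex n (j + n * m) = stdVertex n j := by
  rw [stdVertex_eq, stdVertex_eq, Complex.exp_eq_exp_iff_exists_int]
  refine ⟨((n / 2 : ℕ) : ℤ) * m, ?_⟩
  have := stepAngle_mul h3
  have h2 : (stepAngle n : ℂ) * n = 2 * Real.pi * (n / 2 : ℕ) := by exact_mod_cast this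
  generalize n / 2 = k at h2 ⊢
  push_cast at h2 ⊢
  linear_combination (m : ℂ) * Complex.I * h2

theorem chordDir_add_period (h3 : 3 ≤ n) (j m : ℤ) :
    chordDir n (j + n * m) = chordDir n j := by
  rw [chordDir, chordDir, Complex.exp_eq_exp_iff_exists_int]
  refine ⟨((n / 2 : ℕ) : ℤ) * m, ?_⟩
  have := stepAngle_mul h3
  have h2 : (stepAngle n : ℂ) * n = 2 * Real.pi * (n / 2 : ℕ) := by exact_mod_cast this
  generalize n / 2 = k at h2 ⊢
  push_cast at h2 ⊢
  linear_combination (m : ℂ) * Complex.I * h2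

theorem stdCurve_add_period (h3 : 3 ≤ n) (t : ℝ) (m : ℤ) :
    stdCurve n (t + (n * m : ℤ)) = stdCurve n t := by
  unfold stdCurve
  rw [Int.floor_add_intCast, Int.fract_add_intCast, stdVertex_add_period h3,
    add_right_comm, stdVertex_add_period h3]

theorem exists_mem_Icc_stdCurve_eq (h3 : 3 ≤ n) (t : ℝ) :
    ∃ s ∈ Icc (0 : ℝ) n, ∃ m : ℤ, s = t + (n * m : ℤ) := by
  have hn : (0 : ℝ) < n := by positivity
  refine ⟨t + (n * (-⌊t / n⌋) : ℤ), ⟨?_, ?_⟩, _, rfl⟩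
  · have := Int.floor_le (t / n)
    rw [le_div_iff₀ hn] at this
    push_cast; linarith
  · have := Int.lt_floor_add_one (t / n)
    rw [div_lt_iff₀ hn] at this
    push_cast; linarith

theorem side_congr (h3 : 3 ≤ n) {i j : ℤ} (h : (i : ZMod n) = j) : side n i = side n j := by
  rw [ZMod.intCast_eq_intCast_iff, Int.modEq_iff_add_fac] at h
  obtain ⟨m, rfl⟩ := h
  funext p
  rw [side, side, chordDir_add_period h3]

theorem continuous_side (n : ℕ) (j : ℤ) : Continuous (side n j) := by
  unfold side
  fun_prop

theorem side_chordDir_mul (n : ℕ) (j : ℤ) (q : ℂ) :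
    side n j (chordDir n j * q) = q.re - Real.cos (stepAngle n / 2) := by
  unfold side
  rw [show chordDir n j * q * (starRingEnd ℂ) (chordDir n j) =
    chordDir n j * (starRingEnd ℂ) (chordDir n j) * q by ring, chordDir_mul_conj, one_mul]

/-- Every point can be written in the coordinates adapted to the `j`-th chord. -/
theorem exists_chordDir_mul (n : ℕ) (j : ℤ) (p : ℂ) :
    ∃ q : ℂ, p = chordDir n j * q ∧ ‖q‖ = ‖p‖ ∧
      q.re = side n j p + Real.cos (stepAngle n / 2) := by
  refine ⟨(starRingEnd ℂ) (chordDir n j) * p, ?_, ?_, ?_⟩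
  · rw [← mul_assoc, chordDir_mul_conj, one_mul]
  · rw [norm_mul, RCLike.norm_conj, norm_chordDir, one_mul]
  · rw [side, mul_comm]; ring

theorem side_stdCurve (n : ℕ) (j : ℤ) {t : ℝ} (ht : t ∈ Icc (j : ℝ) (j + 1)) :
    side n j (stdCurve n t) = 0 := by
  rw [stdCurve_eq n j ht, side_chordDir_mul, Complex.add_re, Complex.ofReal_re,
    Complex.re_ofReal_mul, Complex.I_re, mul_zero, add_zero, sub_self]

theorem normSq_stdCurve (n : ℕ) (j : ℤ) {t : ℝ} (ht : t ∈ Icc (j : ℝ) (j + 1)) :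
    ‖stdCurve n t‖ ^ 2 = 1 - 4 * (t - j) * (1 - (t - j)) * Real.sin (stepAngle n / 2) ^ 2 := by
  rw [stdCurve_eq n j ht, norm_mul, norm_chordDir, one_mul, ← Complex.normSq_eq_norm_sq,
    Complex.normSq_add_mul_I]
  linear_combination Real.sin_sq_add_cos_sq (stepAngle n / 2)

theorem norm_stdCurve_le (n : ℕ) (t : ℝ) : ‖stdCurve n t‖ ≤ 1 := by
  have h := normSq_stdCurve n ⌊t⌋ (t := t) ⟨Int.floor_le t, (Int.lt_floor_add_one t).le⟩
  have h1 := Int.floor_le t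
  have h2 := Int.lt_floor_add_one t
  have h3 : 0 ≤ (t - ⌊t⌋) * (1 - (t - ⌊t⌋)) * Real.sin (stepAngle n / 2) ^ 2 :=
    mul_nonneg (mul_nonneg (by linarith) (by linarith)) (sq_nonneg _)
  nlinarith [norm_nonneg (stdCurve n t)]

/-- Only the vertices of the straight-line musquash lie on the circle. -/
theorem norm_stdCurve_lt (h3 : 3 ≤ n) (ho : Odd n) (j : ℤ) {t : ℝ}
    (ht : t ∈ Ioo (j : ℝ) (j + 1)) : ‖stdCurve n t‖ < 1 := by
  have h := normSq_stdCurve n j (Ioo_subset_Icc_self ht)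
  have h4 : 0 < (t - j) * (1 - (t - j)) * Real.sin (stepAngle n / 2) ^ 2 :=
    mul_pos (mul_pos (by linarith [ht.1]) (by linarith [ht.2])) (pow_pos (sin_half_pos h3 ho) 2)
  nlinarith [norm_nonneg (stdCurve n t)]

/-- Within the closed disc, the line through the `j`-th chord is the chord. -/
theorem mem_edge_of_side_eq_zero (h3 : 3 ≤ n) (ho : Odd n) {j : ℤ} {p : ℂ} (hp : ‖p‖ ≤ 1)
    (h : side n j p = 0) : p ∈ stdCurve n '' Icc (j : ℝ) (j + 1) := by
  obtain ⟨q, hpq, hq, hre⟩ := exists_chordDir_mul n j p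
  rw [h, zero_add] at hre
  have hs := sin_half_pos h3 ho
  have h1 : q.re ^ 2 + q.im ^ 2 ≤ 1 := by
    have : Complex.normSq q ≤ 1 := by
      rw [Complex.normSq_eq_norm_sq, hq]; nlinarith [norm_nonneg p]
    rw [Complex.normSq_apply] at this
    linarith
  have h2 : q.im ^ 2 ≤ Real.sin (stepAngle n / 2) ^ 2 := by
    have := Real.sin_sq_add_cos_sq (stepAngle n / 2)
    rw [hre] at h1; linarith
  have h4 := abs_le.1 (abs_le_of_sq_le_sq h2 hs.le)
  have ht : (q.im / Real.sin (stepAngle n / 2) + 1) / 2 ∈ Icc (0 : ℝ) 1 := by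
    have ha : -1 ≤ q.im / Real.sin (stepAngle n / 2) := by rw [le_div_iff₀ hs]; linarith
    have hb : q.im / Real.sin (stepAngle n / 2) ≤ 1 := by rw [div_le_iff₀ hs]; linarith
    constructor <;> linarith
  have ht' : j + (q.im / Real.sin (stepAngle n / 2) + 1) / 2 ∈ Icc (j : ℝ) (j + 1) :=
    ⟨by linarith [ht.1], by linarith [ht.2]⟩
  refine ⟨_, ht', ?_⟩
  rw [stdCurve_eq n j ht', hpq, ← hre]
  have h5 : (2 * (j + (q.im / Real.sin (stepAngle n / 2) + 1) / 2 - j) - 1) *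
      Real.sin (stepAngle n / 2) = q.im := by
    field_simp; ring
  rw [h5, Complex.re_add_im]

theorem side_add_side_succ (n : ℕ) (j : ℤ) (p : ℂ) :
    side n j p + side n (j + 1) p = 2 * Real.cos (stepAngle n / 2) *
      ((p * (starRingEnd ℂ) (stdVertex n (j + 1))).re - 1) := by
  have h1 : chordDir n j + chordDir n (j + 1) =
      (2 * Real.cos (stepAngle n / 2) : ℝ) * stdVertex n (j + 1) := by
    have ha := stdVertex_succ_eq_chordDir n j
    have hb := stdVertex_eq_chordDir n (j + 1)
    have h2 : (Real.cos (stepAngle n / 2) : ℂ) ^ 2 + Real.sin (stepAngle n / 2) ^ 2 = 1 := by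
      exact_mod_cast Real.cos_sq_add_sin_sq _
    have h3 := Complex.I_sq
    set c := Complex.ofReal (Real.cos (stepAngle n / 2))
    set s := Complex.ofReal (Real.sin (stepAngle n / 2))
    have h4 : chordDir n j = stdVertex n (j + 1) * (c - s * Complex.I) := by
      rw [ha]; linear_combination (-chordDir n j) * h2 + chordDir n j * s ^ 2 * h3
    have h5 : chordDir n (j + 1) = stdVertex n (j + 1) * (c + s * Complex.I) := by
      rw [hb]; linear_combination (-chordDir n (j + 1)) * h2 + chordDir n (j + 1) * s ^ 2 * h3
    rw [h4, h5, Complex.ofReal_mul, Complex.ofReal_ofNat]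
    change _ = 2 * c * _
    ring
  have h2 : (p * (starRingEnd ℂ) (chordDir n j)).re + (p * (starRingEnd ℂ) (chordDir n (j + 1))).re
      = 2 * Real.cos (stepAngle n / 2) * (p * (starRingEnd ℂ) (stdVertex n (j + 1))).re := by
    rw [← Complex.add_re, ← mul_add, ← map_add, h1, map_mul, Complex.conj_ofReal, mul_left_comm,
      Complex.re_ofReal_mul]
  unfold side
  linear_combination h2

/-- No point of the disc is cut off by two consecutive chords. -/
theorem not_side_pos_succ (h3 : 3 ≤ n) (ho : Odd n) {j : ℤ} {p : ℂ} (hp : ‖p‖ ≤ 1)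
    (h : 0 < side n j p) : ¬ 0 < side n (j + 1) p := by
  intro h'
  have h1 := side_add_side_succ n j p
  have h2 : (p * (starRingEnd ℂ) (stdVertex n (j + 1))).re ≤ 1 := by
    refine (Complex.re_le_norm _).trans ?_
    rw [norm_mul, RCLike.norm_conj, norm_stdVertex, mul_one]; exact hp
  nlinarith [cos_half_pos h3 ho]

open Classical in
/-- The set of the chords that cut off the point `p` of the disc from the centre. -/
def cutSet (n : ℕ) [NeZero n] (p : ℂ) : Finset (ZMod n) :=
  Finset.univ.filter fun j => 0 < side n (j.val : ℤ) p

theorem mem_cutSet [NeZero n] (h3 : 3 ≤ n) {p : ℂ} (j : ℤ) :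
    (j : ZMod n) ∈ cutSet n p ↔ 0 < side n j p := by
  rw [cutSet, Finset.mem_filter, side_congr h3 (i := ((j : ZMod n).val : ℤ)) (j := j) (by simp)]
  simp

theorem indep_cutSet [NeZero n] (h3 : 3 ≤ n) (ho : Odd n) {p : ℂ} (hp : ‖p‖ ≤ 1) :
    Indep (cutSet n p) := by
  intro j hj hj'
  obtain ⟨i, rfl⟩ := ZMod.intCast_surjective j
  rw [mem_cutSet h3] at hj
  rw [← Int.cast_one, ← Int.cast_add, mem_cutSet h3] at hj'
  exact not_side_pos_succ h3 ho hp hj hj'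

/-! ### Rotation numbers of the straight-line musquash -/

theorem sub_stdVertex (n : ℕ) (j : ℤ) (p : ℂ) :
    stdVertex n j - p = stdVertex n j * (1 - p * (starRingEnd ℂ) (stdVertex n j)) := by
  have : stdVertex n j * (starRingEnd ℂ) (stdVertex n j) = 1 := by
    rw [Complex.mul_conj, Complex.normSq_eq_norm_sq, norm_stdVertex]; simp
  linear_combination p * this

theorem one_sub_mul_conj_re_pos {p : ℂ} (hp : ‖p‖ < 1) (j : ℤ) :
    0 < (1 - p * (starRingEnd ℂ) (stdVertex n j)).re := by
  have : (p * (starRingEnd ℂ) (stdVertex n j)).re < 1 := by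
    refine (Complex.re_le_norm _).trans_lt ?_
    rw [norm_mul, RCLike.norm_conj, norm_stdVertex, mul_one]; exact hp
  rw [Complex.sub_re, Complex.one_re]; linarith

theorem stdVertex_sub_ne_zero {p : ℂ} (hp : ‖p‖ < 1) (j : ℤ) : stdVertex n j - p ≠ 0 := by
  intro h
  rw [sub_eq_zero] at h
  rw [← h, norm_stdVertex] at hp
  exact lt_irrefl _ hp

/-- The ratio of the vectors from `p` to the end and to the start of the `j`-th chord. -/
def vertexRatio (n : ℕ) (p : ℂ) (j : ℤ) : ℂ := (stdVertex n (j + 1) - p) / (stdVertex n j - p)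

/-- Seen from `p`, the `j`-th chord is traversed counterclockwise exactly if `p` is on the side of
the centre. -/
theorem vertexRatio_im (n : ℕ) (p : ℂ) (j : ℤ) :
    (vertexRatio n p j).im * Complex.normSq (stdVertex n j - p) =
      -(2 * Real.sin (stepAngle n / 2)) * side n j p := by
  by_cases h0 : stdVertex n j - p = 0
  · have h1 : p = stdVertex n j := (sub_eq_zero.1 h0).symm
    have : side n j p = 0 := by
      rw [h1, ← stdCurve_intCast, side_stdCurve n j ⟨le_rfl, by linarith⟩]
    simp [h0, this]
  · have h2 : vertexRatio n p j * Complex.normSq (stdVertex n j - p) =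
        (stdVertex n (j + 1) - p) * (starRingEnd ℂ) (stdVertex n j - p) := by
      rw [vertexRatio, ← Complex.mul_conj, ← mul_assoc, div_mul_cancel₀ _ h0]
    rw [← Complex.im_mul_ofReal, h2]
    obtain ⟨q, hpq, -, hre⟩ := exists_chordDir_mul n j p
    have h3 := chordDir_mul_conj n j
    rw [stdVertex_succ_eq_chordDir, stdVertex_eq_chordDir, hpq, ← mul_sub, ← mul_sub, map_mul,
      show ∀ a b c d : ℂ, a * b * (c * d) = a * c * (b * d) by intros; ring, h3, one_mul,
      ← hpq, show side n j p = q.re - Real.cos (stepAngle n / 2) by linarith]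
    simp only [Complex.mul_im, Complex.sub_re, Complex.add_re, Complex.sub_im, Complex.add_im,
      Complex.conj_re, Complex.conj_im, Complex.ofReal_re, Complex.ofReal_im, Complex.mul_re,
      Complex.I_re, Complex.I_im]
    ring

/-- The vector from `p` to a vertex deviates from the direction of the vertex by the argument of
`1 - p * conj v`. If the `j`-th chord cuts off `p`, this deviation is negative at the start of the
chord and nonnegative at its end. -/
theorem im_one_sub_mul_conj (h3 : 3 ≤ n) (ho : Odd n) {p : ℂ} (hp : ‖p‖ < 1) {j : ℤ}
    (h : 0 < side n j p) : 0 ≤ (1 - p * (starRingEnd ℂ) (stdVertex n (j + 1))).im ∧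
      (1 - p * (starRingEnd ℂ) (stdVertex n j)).im < 0 := by
  obtain ⟨q, hpq, hq, hre⟩ := exists_chordDir_mul n j p
  have hu := chordDir_mul_conj n j
  have hs := sin_half_pos h3 ho
  have hc := cos_half_pos h3 ho
  have hn : q.re ^ 2 + q.im ^ 2 < 1 := by
    have : Complex.normSq q < 1 := by
      rw [Complex.normSq_eq_norm_sq, hq]; nlinarith [norm_nonneg p]
    rw [Complex.normSq_apply] at this
    linarith
  have hsc := Real.sin_sq_add_cos_sq (stepAngle n / 2)
  rw [stdVertex_succ_eq_chordDir, stdVertex_eq_chordDir, hpq, map_mul, map_mul,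
      show ∀ a b c d : ℂ, a * b * (c * d) = a * c * (b * d) by intros; ring, hu, one_mul,
      show ∀ a b c d : ℂ, a * b * (c * d) = a * c * (b * d) by intros; ring, hu, one_mul]
  simp only [map_add, map_sub, map_mul, Complex.conj_ofReal, Complex.conj_I]
  simp only [Complex.mul_im, Complex.sub_re, Complex.add_re, Complex.sub_im, Complex.add_im,
      Complex.ofReal_re, Complex.ofReal_im, Complex.mul_re, Complex.neg_re, Complex.neg_im,
      Complex.I_re, Complex.I_im, Complex.one_im]
  set s := Real.sin (stepAngle n / 2)
  set c := Real.cos (stepAngle n / 2)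
  have hx : c < q.re := by linarith
  have hy : q.im ^ 2 < s ^ 2 := by nlinarith
  have hy' := abs_lt.1 (abs_lt_of_sq_lt_sq hy hs.le)
  have h1 : c * s < q.re * s := mul_lt_mul_of_pos_right hx hs
  have h2 : q.im * c < s * c := mul_lt_mul_of_pos_right hy'.2 hc
  have h4 : -s * c < q.im * c := mul_lt_mul_of_pos_right hy'.1 hc
  constructor <;> nlinarith

open Classical in
/-- The change of the angle along a chord is the change of the angle along the corresponding arc
of the circle, diminished by one full turn if the chord cuts off the point `p`. -/
theorem log_vertexRatio (h3 : 3 ≤ n) (ho : Odd n) {p : ℂ} (hp : ‖p‖ < 1) {j : ℤ}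
    (h : side n j p ≠ 0) : Complex.log (vertexRatio n p j) =
      stepAngle n * Complex.I + Complex.log (1 - p * (starRingEnd ℂ) (stdVertex n (j + 1))) -
      Complex.log (1 - p * (starRingEnd ℂ) (stdVertex n j)) -
      (if 0 < side n j p then 1 else 0 : ℤ) * (2 * Real.pi * Complex.I) := by
  set a := 1 - p * (starRingEnd ℂ) (stdVertex n j) with ha
  set b := 1 - p * (starRingEnd ℂ) (stdVertex n (j + 1)) with hb
  have hare : 0 < a.re := one_sub_mul_conj_re_pos hp j
  have hbre : 0 < b.re := one_sub_mul_conj_re_pos hp (j + 1)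
  have ha0 : a ≠ 0 := fun h => by rw [h] at hare; exact lt_irrefl _ hare
  have hb0 : b ≠ 0 := fun h => by rw [h] at hbre; exact lt_irrefl _ hbre
  set D : ℂ := stepAngle n * Complex.I + Complex.log b - Complex.log a with hD
  have hDim : D.im = stepAngle n + b.arg - a.arg := by
    simp [hD, Complex.log_im]
  have hexp : vertexRatio n p j = Complex.exp D := by
    rw [hD, Complex.exp_sub, Complex.exp_add, Complex.exp_log ha0, Complex.exp_log hb0,
      vertexRatio, sub_stdVertex, sub_stdVertex n j, ← hb, ← ha]
    have : stdVertex n (j + 1) = stdVertex n j * Complex.exp (stepAngle n * Complex.I) := by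
      rw [stdVertex_eq, stdVertex_eq, ← Complex.exp_add]
      congr 1; push_cast; ring
    have h0 : stdVertex n j ≠ 0 := norm_ne_zero_iff.1 (by rw [norm_stdVertex]; exact one_ne_zero)
    rw [this]
    field_simp
  have him : (vertexRatio n p j).im = Real.exp D.re * Real.sin D.im := by
    rw [hexp, Complex.exp_im]
  have hns : 0 < Complex.normSq (stdVertex n j - p) :=
    Complex.normSq_pos.2 (stdVertex_sub_ne_zero hp j)
  have hside := vertexRatio_im n p j
  have hs := sin_half_pos h3 ho
  have hδ := stepAngle_pos h3
  have hδ' := stepAngle_lt_pi h3 ho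
  have ha1 := Complex.abs_arg_lt_pi_div_two_iff.2 (Or.inl hare)
  have hb1 := Complex.abs_arg_lt_pi_div_two_iff.2 (Or.inl hbre)
  rw [abs_lt] at ha1 hb1
  have hexpos := Real.exp_pos D.re
  rcases lt_or_gt_of_ne h with h | h
  · have hpos : 0 < Real.sin D.im := by
      have : 0 < (vertexRatio n p j).im * Complex.normSq (stdVertex n j - p) := by
        rw [hside]; nlinarith
      have := pos_of_mul_pos_left this hns.le
      rw [him] at this
      exact pos_of_mul_pos_right this hexpos.le
    have hle : D.im ≤ Real.pi := by
      by_contra hcon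
      push Not at hcon
      have := Real.sin_nonneg_of_nonneg_of_le_pi (x := D.im - Real.pi) (by linarith)
        (by linarith)
      rw [Real.sin_sub_pi] at this
      linarith
    rw [if_neg (not_lt.2 h.le), hexp, Complex.log_exp (by linarith) hle]
    simp
  · have hneg : Real.sin D.im < 0 := by
      have : (vertexRatio n p j).im * Complex.normSq (stdVertex n j - p) < 0 := by
        rw [hside]; nlinarith
      have := neg_of_mul_neg_left this hns.le
      rw [him] at this
      exact neg_of_mul_neg_right this hexpos.le
    obtain ⟨h1, h2⟩ := im_one_sub_mul_conj h3 ho hp h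
    have hb2 : 0 ≤ b.arg := Complex.arg_nonneg_iff.2 h1
    have ha2 : a.arg < 0 := Complex.arg_neg_iff.2 h2
    have hgt : Real.pi < D.im := by
      by_contra hcon
      push Not at hcon
      have := Real.sin_nonneg_of_nonneg_of_le_pi (x := D.im) (by linarith) hcon
      linarith
    have him2 : (D - 2 * Real.pi * Complex.I).im = D.im - 2 * Real.pi := by simp
    rw [if_pos h, hexp, ← Complex.exp_periodic.sub_eq D, Complex.log_exp (by linarith)
      (by linarith)]
    simp

/-- A continuous logarithm changes along the `j`-th edge by the principal logarithm of the quotient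
of its ends: the edge is straight and misses `p`. -/
theorem log_change_edge (h3 : 3 ≤ n) (ho : Odd n) {p : ℂ} (hp : ‖p‖ < 1) {j : ℤ}
    (h : side n j p ≠ 0) {g : ℝ → ℂ} (hg : Continuous g)
    (hgf : ∀ t, stdCurve n t - p = Complex.exp (g t)) :
    g (j + 1) - g j = Complex.log (vertexRatio n p j) := by
  have h0 := stdVertex_sub_ne_zero (n := n) hp j
  have hline : ∀ s ∈ Icc (0 : ℝ) 1, (stdCurve n (j + s) - p) / (stdVertex n j - p) =
      1 + s * (vertexRatio n p j - 1) := fun s hs => by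
    rw [stdCurve_eq_lineMap n j ⟨by linarith [hs.1], by linarith [hs.2]⟩, add_sub_cancel_left,
      AffineMap.lineMap_apply, vertexRatio]
    simp only [vsub_eq_sub, vadd_eq_add, Complex.real_smul]
    field_simp
    ring
  have him : (vertexRatio n p j).im ≠ 0 := by
    intro h1
    have h2 := vertexRatio_im n p j
    rw [h1, zero_mul] at h2
    have := sin_half_pos h3 ho
    rcases mul_eq_zero.1 h2.symm with h4 | h4
    · linarith
    · exact h h4
  have hslit : ∀ s : Icc (0 : ℝ) 1, 1 + (s : ℝ) * (vertexRatio n p j - 1) ∈ Complex.slitPlane := by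
    rintro ⟨s, hs⟩
    rcases hs.1.eq_or_lt with h1 | h1
    · left; simp [← h1]
    · right
      simp [h1.ne', him]
  have hcont : Continuous fun s : Icc (0 : ℝ) 1 => g (j + s) - g j -
      Complex.log (1 + (s : ℝ) * (vertexRatio n p j - 1)) := by
    refine Continuous.sub (by fun_prop) (Continuous.clog (by fun_prop) hslit)
  have hconst := exp_period_const hcont (fun s => by
    rw [Complex.exp_sub, Complex.exp_sub, ← hgf, ← hgf, stdCurve_intCast,
      Complex.exp_log (Complex.slitPlane_ne_zero (hslit s)), hline s s.2, div_self]
    exact Complex.slitPlane_ne_zero (hslit s)) ⟨1, by simp⟩ ⟨0, by simp⟩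
  simp only [Complex.ofReal_one, one_mul, Complex.ofReal_zero, zero_mul, add_zero, sub_self,
    Complex.log_one, add_sub_cancel] at hconst
  linear_combination hconst

theorem sum_cutSet [NeZero n] (p : ℂ) :
    ∑ j ∈ Finset.range n, (open Classical in if 0 < side n (j : ℤ) p then 1 else 0 : ℤ) =
      (cutSet n p).card := by
  classical
  rw [cutSet, Finset.card_filter]
  push_cast
  symm
  refine Finset.sum_bij' (fun j _ => j.val) (fun i _ => (i : ZMod n)) ?_ ?_ ?_ ?_ ?_
  · intro j _; exact Finset.mem_range.2 j.val_lt
  · intro i _; exact Finset.mem_univ _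
  · intro j _; simp
  · intro i hi; exact ZMod.val_cast_of_lt (Finset.mem_range.1 hi)
  · intro j _; rfl

/-- The label of a point of the open disc is the label `n / 2` of the centre, diminished by the
number of the chords that cut off the point from the centre. -/
theorem hasWinding_disc [NeZero n] (h3 : 3 ≤ n) (ho : Odd n) {p : ℂ} (hp : ‖p‖ < 1)
    (h : ∀ j, side n j p ≠ 0) :
    HasWinding (fun t => stdCurve n t - p) n ((n / 2 : ℕ) - (cutSet n p).card) := by
  have hne : ∀ t, stdCurve n t - p ≠ 0 := fun t ht => by
    apply h ⌊t⌋
    rw [← sub_eq_zero.1 ht, side_stdCurve n _ ⟨Int.floor_le t, (Int.lt_floor_add_one t).le⟩]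
  obtain ⟨g, hg, hgf⟩ := exists_continuous_log (f := fun t => stdCurve n t - p)
    ((continuous_stdCurve n).sub continuous_const) hne
  refine ⟨g, hg, hgf, ?_⟩
  have h1 : ∀ m : ℕ, g m - g 0 = m * (stepAngle n * Complex.I) +
      Complex.log (1 - p * (starRingEnd ℂ) (stdVertex n m)) -
      Complex.log (1 - p * (starRingEnd ℂ) (stdVertex n 0)) -
      (∑ j ∈ Finset.range m, (open Classical in if 0 < side n (j : ℤ) p then 1 else 0 : ℤ) : ℤ) *
        (2 * Real.pi * Complex.I) := by
    intro m
    induction m with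
    | zero => simp
    | succ m ih =>
      have h2 := log_change_edge h3 ho hp (h m) hg hgf
      rw [log_vertexRatio h3 ho hp (h m)] at h2
      rw [Finset.sum_range_succ]
      push_cast at h2 ih ⊢
      linear_combination h2 + ih
  have h2 := h1 n
  have h4 : stdVertex n n = stdVertex n 0 := by
    have := stdVertex_add_period h3 0 1
    simpa using this
  have h5 : (stepAngle n : ℂ) * n = 2 * Real.pi * (n / 2 : ℕ) := by
    exact_mod_cast stepAngle_mul h3
  rw [sum_cutSet, h4] at h2
  rw [h2]
  generalize n / 2 = k at h5 ⊢
  push_cast at h5 ⊢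
  linear_combination Complex.I * h5

theorem stdCurve_natCast_self (h3 : 3 ≤ n) : stdCurve n n = stdCurve n 0 := by
  have := stdCurve_add_period h3 0 1
  simpa using this

/-- The musquash does not wind around a point `p` outside the open disc: it misses the ray that
starts at `p` and leads away from the centre. -/
theorem hasWinding_outside (h3 : 3 ≤ n) {p : ℂ} (hp : 1 ≤ ‖p‖) (h : ∀ t, stdCurve n t ≠ p) :
    HasWinding (fun t => stdCurve n t - p) n 0 := by
  have hp0 : p ≠ 0 := fun h => by rw [h, norm_zero] at hp; linarith
  have h1 : HasWinding (fun t => 1 - stdCurve n t / p) n 0 := by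
    refine HasWinding.of_slitPlane (by have := continuous_stdCurve n; fun_prop) (fun t => ?_)
      (by simp only [stdCurve_natCast_self h3])
    have hle : ‖stdCurve n t / p‖ ≤ 1 := by
      rw [norm_div]
      exact div_le_one_of_le₀ ((norm_stdCurve_le n t).trans hp) (norm_nonneg _)
    have hre := Complex.re_le_norm (stdCurve n t / p)
    rw [Complex.mem_slitPlane_iff]
    by_contra hcon
    push Not at hcon
    obtain ⟨h4, h5⟩ := hcon
    rw [Complex.sub_re, Complex.one_re] at h4
    rw [Complex.sub_im, Complex.one_im, zero_sub, neg_eq_zero] at h5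
    have h6 : stdCurve n t / p = 1 := by
      apply Complex.ext
      · rw [Complex.one_re]; linarith
      · rw [h5, Complex.one_im]
    exact h t ((div_eq_one_iff_eq hp0).1 h6)
  have h2 := (HasWinding.const (neg_ne_zero.2 hp0) n).mul h1
  rw [zero_add] at h2
  convert h2 using 2 with t
  field_simp
  ring

/-- The rotation number around `p` is locally constant off the curve. -/
theorem HasWinding.eventually_nhds {f : ℝ → ℂ} {L : ℝ} {k : ℤ} {p : ℂ}
    (hk : HasWinding (fun t => f t - p) L k) (hf : Continuous f) (hL : f L = f 0)
    (hc : IsCompact (range f)) : ∀ᶠ q in nhds p, HasWinding (fun t => f t - q) L k := by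
  have hp : p ∉ range f := by
    rintro ⟨t, ht⟩
    obtain ⟨g, -, hg, -⟩ := hk
    have := hg t
    simp only [ht, sub_self] at this
    exact Complex.exp_ne_zero _ this.symm
  obtain ⟨ε, hε, hε'⟩ := Metric.isOpen_iff.1 hc.isClosed.isOpen_compl p hp
  filter_upwards [Metric.ball_mem_nhds p hε] with q hq
  refine hk.of_norm_sub_lt (by fun_prop) (by fun_prop) (by rw [hL]) (by rw [hL]) fun t => ?_
  have h1 : ε ≤ ‖f t - p‖ := by
    by_contra hcon
    push Not at hcon
    exact hε' (a := f t) (by rwa [Metric.mem_ball, dist_eq_norm]) ⟨t, rfl⟩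
  rw [Metric.mem_ball, dist_comm, dist_eq_norm] at hq
  rw [show f t - q - (f t - p) = p - q by ring]
  linarith

theorem range_stdCurve (h3 : 3 ≤ n) : range (stdCurve n) = stdCurve n '' Icc 0 (n : ℝ) := by
  refine Subset.antisymm ?_ (image_subset_range _ _)
  rintro _ ⟨t, rfl⟩
  obtain ⟨s, hs, m, rfl⟩ := exists_mem_Icc_stdCurve_eq h3 t
  exact ⟨_, hs, stdCurve_add_period h3 t m⟩

theorem isCompact_range_stdCurve (h3 : 3 ≤ n) : IsCompact (range (stdCurve n)) := by
  rw [range_stdCurve h3]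
  exact isCompact_Icc.image (continuous_stdCurve n)

/-- A point of the circle other than the vertices is cut off by `n / 2` chords: its rotation
number vanishes. -/
theorem card_cutSet_of_norm_eq_one [NeZero n] (h3 : 3 ≤ n) (ho : Odd n) {q : ℂ} (hq : ‖q‖ = 1)
    (h : ∀ j, side n j q ≠ 0) : (cutSet n q).card = n / 2 := by
  have hne : ∀ t, stdCurve n t ≠ q := fun t ht => by
    apply h ⌊t⌋
    rw [← ht, side_stdCurve n _ ⟨Int.floor_le t, (Int.lt_floor_add_one t).le⟩]
  have h1 := (hasWinding_outside h3 hq.ge hne).eventually_nhds (continuous_stdCurve n)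
    (stdCurve_natCast_self h3) (isCompact_range_stdCurve h3)
  have h2 : ∀ᶠ p in nhds q, ∀ j : ZMod n,
      side n (j.val : ℤ) p ≠ 0 ∧ (0 < side n (j.val : ℤ) p ↔ 0 < side n (j.val : ℤ) q) := by
    rw [Filter.eventually_all]
    intro j
    have hc := (continuous_side n (j.val : ℤ)).tendsto q
    rcases lt_or_gt_of_ne (h (j.val : ℤ)) with h3 | h3
    · filter_upwards [hc.eventually (gt_mem_nhds h3)] with p hp
      exact ⟨hp.ne, iff_of_false hp.not_gt h3.not_gt⟩
    · filter_upwards [hc.eventually (lt_mem_nhds h3)] with p hp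
      exact ⟨hp.ne', iff_of_true hp h3⟩
  have h4 : ∃ᶠ p in nhds q, ‖p‖ < 1 := by
    have : q ∈ closure (Metric.ball (0 : ℂ) 1) := by
      rw [closure_ball _ one_ne_zero]; simp [hq]
    rw [mem_closure_iff_frequently] at this
    simpa using this
  obtain ⟨p, hp, hp1, hp2⟩ := (h4.and_eventually (h1.and h2)).exists
  have h5 : ∀ j, side n j p ≠ 0 := fun j => by
    rw [← side_congr h3 (i := ((j : ZMod n).val : ℤ)) (j := j) (by simp)]
    exact (hp2 _).1
  have h6 := (hasWinding_disc h3 ho hp h5).unique hp1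
  have h7 : cutSet n p = cutSet n q := by
    ext j
    simp only [cutSet, Finset.mem_filter, Finset.mem_univ, true_and]
    exact (hp2 j).2
  rw [h7] at h6
  lia

/-! ### A curve that crosses every chord once -/

theorem mul_pos_of_continuousOn_of_ne_zero {F : ℝ → ℝ} {s t : ℝ} (hst : s ≤ t)
    (hF : ContinuousOn F (Icc s t)) (h0 : ∀ r ∈ Icc s t, F r ≠ 0) : 0 < F s * F t := by
  have hs := h0 s (left_mem_Icc.2 hst)
  have ht := h0 t (right_mem_Icc.2 hst)
  by_contra hcon
  rcases lt_or_gt_of_ne hs with h1 | h1 <;> rcases lt_or_gt_of_ne ht with h2 | h2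
  · exact hcon (mul_pos_of_neg_of_neg h1 h2)
  · obtain ⟨r, hr, hr0⟩ := intermediate_value_Icc hst hF ⟨h1.le, h2.le⟩
    exact h0 r hr hr0
  · obtain ⟨r, hr, hr0⟩ := intermediate_value_Icc' hst hF ⟨h2.le, h1.le⟩
    exact h0 r hr hr0
  · exact hcon (mul_pos h1 h2)

/-- A curve `z` in the plane (which may jump far away from the disc) that for `t ∈ [0, 1]` meets the
`j`-th edge of the straight-line musquash at the time `τ j` only, and crosses it there. -/
structure CrossesEdges (n : ℕ) (z : ℝ → ℂ) (τ : ZMod n → ℝ) : Prop where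
  isOpen_disc : IsOpen {t | ‖z t‖ < 1}
  isClosed_disc : IsClosed {t | ‖z t‖ ≤ 1}
  continuousOn : ContinuousOn z {t | ‖z t‖ ≤ 1}
  time_mem : ∀ j, τ j ∈ Ioo (0 : ℝ) 1
  norm_lt : ∀ j, ‖z (τ j)‖ < 1
  mem_edge : ∀ j, ∀ t ∈ Icc (0 : ℝ) 1,
    z t ∈ stdCurve n '' Icc ((j.val : ℤ) : ℝ) ((j.val : ℤ) + 1) ↔ t = τ j
  flip : ∀ j, ∃ ε > 0, ∀ s ∈ Ioo (τ j - ε) (τ j), ∀ t ∈ Ioo (τ j) (τ j + ε),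
    side n (j.val : ℤ) (z s) * side n (j.val : ℤ) (z t) < 0

open Classical in
/-- The edges that are crossed between the times `s` and `t`. -/
def crossed {n : ℕ} [NeZero n] (τ : ZMod n → ℝ) (s t : ℝ) : Finset (ZMod n) :=
  Finset.univ.filter fun j => s < τ j ∧ τ j < t

theorem mem_crossed {n : ℕ} [NeZero n] {τ : ZMod n → ℝ} {s t : ℝ} {j : ZMod n} :
    j ∈ crossed τ s t ↔ s < τ j ∧ τ j < t := by
  simp [crossed]

theorem crossed_self {n : ℕ} [NeZero n] (τ : ZMod n → ℝ) (s : ℝ) : crossed τ s s = ∅ := by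
  ext j
  simpa [mem_crossed] using fun h => le_of_lt h

theorem crossed_union {n : ℕ} [NeZero n] {τ : ZMod n → ℝ} {r s t : ℝ} (hrs : r ≤ s) (hst : s ≤ t)
    (hs : ∀ j, τ j ≠ s) : crossed τ r t = crossed τ r s ∪ crossed τ s t := by
  ext j
  simp only [Finset.mem_union, mem_crossed]
  have := hs j
  constructor
  · rintro ⟨h1, h2⟩
    rcases lt_or_gt_of_ne this with h | h
    · exact Or.inl ⟨h1, h⟩
    · exact Or.inr ⟨h, h2⟩
  · rintro (⟨h1, h2⟩ | ⟨h1, h2⟩)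
    · exact ⟨h1, h2.trans_le hst⟩
    · exact ⟨hrs.trans_lt h1, h2⟩

theorem disjoint_crossed {n : ℕ} [NeZero n] {τ : ZMod n → ℝ} {q r s t : ℝ} (hrs : r ≤ s) :
    Disjoint (crossed τ q r) (crossed τ s t) := by
  rw [Finset.disjoint_left]
  intro j h1 h2
  rw [mem_crossed] at h1 h2
  linarith [h1.2, h2.1]

open Classical in
/-- The rotation number of the straight-line musquash around a point `p` off the curve. -/
def stdLabel (n : ℕ) [NeZero n] (p : ℂ) : ℤ :=
  if ‖p‖ < 1 then (n / 2 : ℕ) - (cutSet n p).card else 0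

namespace CrossesEdges

variable {n : ℕ} {z : ℝ → ℂ} {τ : ZMod n → ℝ}

theorem time_ne (h : CrossesEdges n z τ) {t : ℝ} (ht : 1 ≤ ‖z t‖) (j : ZMod n) : τ j ≠ t := by
  rintro rfl
  exact (h.norm_lt j).not_ge ht

theorem side_eq_zero_iff (h : CrossesEdges n z τ) (h3 : 3 ≤ n) (ho : Odd n) {t : ℝ}
    (ht : t ∈ Icc (0 : ℝ) 1) (hz : ‖z t‖ ≤ 1) (j : ZMod n) :
    side n (j.val : ℤ) (z t) = 0 ↔ t = τ j := by
  rw [← h.mem_edge j t ht]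
  constructor
  · exact mem_edge_of_side_eq_zero h3 ho hz
  · rintro ⟨r, hr, hrt⟩
    rw [← hrt, side_stdCurve n _ hr]

theorem side_ne_zero [NeZero n] (h : CrossesEdges n z τ) (h3 : 3 ≤ n) (ho : Odd n) {t : ℝ}
    (ht : t ∈ Icc (0 : ℝ) 1) (hz : ‖z t‖ ≤ 1) (hτ : ∀ j, τ j ≠ t) (j : ℤ) :
    side n j (z t) ≠ 0 := by
  rw [← side_congr h3 (i := ((j : ZMod n).val : ℤ)) (j := j) (by simp), Ne,
    h.side_eq_zero_iff h3 ho ht hz]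
  exact (hτ _).symm

/-- As long as the curve stays in the disc, the chords crossed are those that cut off exactly one of
its ends from the centre. -/
theorem crossed_eq_symmDiff [NeZero n] (h : CrossesEdges n z τ) (h3 : 3 ≤ n) (ho : Odd n)
    {s t : ℝ} (hs0 : 0 ≤ s) (hst : s ≤ t) (ht1 : t ≤ 1) (hdisc : ∀ r ∈ Icc s t, ‖z r‖ ≤ 1)
    (hs : ∀ j, τ j ≠ s) (ht : ∀ j, τ j ≠ t) :
    crossed τ s t = symmDiff (cutSet n (z s)) (cutSet n (z t)) := by
  ext j
  have hF : ContinuousOn (fun r => side n (j.val : ℤ) (z r)) (Icc s t) :=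
    (continuous_side n _).comp_continuousOn (h.continuousOn.mono hdisc)
  have hF0 : ∀ r ∈ Icc s t, side n (j.val : ℤ) (z r) = 0 ↔ r = τ j := fun r hr =>
    h.side_eq_zero_iff h3 ho ⟨hs0.trans hr.1, hr.2.trans ht1⟩ (hdisc r hr) j
  rw [mem_crossed, Finset.mem_symmDiff]
  simp only [cutSet, Finset.mem_filter, Finset.mem_univ, true_and]
  set F := fun r => side n (j.val : ℤ) (z r) with hFdef
  change _ ↔ (0 < F s ∧ ¬ 0 < F t ∨ 0 < F t ∧ ¬ 0 < F s)
  by_cases hj : s < τ j ∧ τ j < t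
  · refine iff_of_true hj ?_
    obtain ⟨ε, hε, hflip⟩ := h.flip j
    obtain ⟨s', hs1, hs2⟩ := exists_between (max_lt hj.1 (sub_lt_self (τ j) hε))
    obtain ⟨t', ht1, ht2⟩ := exists_between (lt_min hj.2 (lt_add_of_pos_right (τ j) hε))
    rw [max_lt_iff] at hs1
    rw [lt_min_iff] at ht2
    have h1 := mul_pos_of_continuousOn_of_ne_zero (F := F) hs1.1.le
      (hF.mono (Icc_subset_Icc le_rfl (hs2.trans hj.2).le)) fun r hr hr0 => by
        have := (hF0 r ⟨hr.1, hr.2.trans (hs2.trans hj.2).le⟩).1 hr0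
        linarith [hr.2]
    have h2 := mul_pos_of_continuousOn_of_ne_zero (F := F) ht2.1.le
      (hF.mono (Icc_subset_Icc (hj.1.trans ht1).le le_rfl)) fun r hr hr0 => by
        have := (hF0 r ⟨(hj.1.trans ht1).le.trans hr.1, hr.2⟩).1 hr0
        linarith [hr.1]
    have h4 : F s' * F t' < 0 := hflip s' ⟨hs1.2, hs2⟩ t' ⟨ht1, ht2.2⟩
    rcases mul_neg_iff.1 h4 with ⟨h5, h6⟩ | ⟨h5, h6⟩
    · left
      exact ⟨pos_of_mul_pos_left h1 h5.le, (neg_of_mul_pos_right h2 h6.le).not_gt⟩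
    · right
      exact ⟨pos_of_mul_pos_right h2 h6.le, (neg_of_mul_pos_left h1 h5.le).not_gt⟩
  · refine iff_of_false hj ?_
    have h1 := mul_pos_of_continuousOn_of_ne_zero hst hF fun r hr hr0 => by
      have h2 := (hF0 r hr).1 hr0
      exact hj ⟨lt_of_le_of_ne (h2 ▸ hr.1) (hs j).symm, lt_of_le_of_ne (h2 ▸ hr.2) (ht j)⟩
    rcases mul_pos_iff.1 h1 with ⟨h5, h6⟩ | ⟨h5, h6⟩
    · simp [h5, h6]
    · simp [h5.not_gt, h6.not_gt]

/-- The last time before `r` at which the curve is not in the open disc. -/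
theorem exists_last_entry (h : CrossesEdges n z τ) {s r : ℝ} (hsr : s ≤ r) (hs : 1 ≤ ‖z s‖)
    (hr : ‖z r‖ < 1) : ∃ a, s ≤ a ∧ a < r ∧ ‖z a‖ = 1 ∧ ∀ x ∈ Ioc a r, ‖z x‖ < 1 := by
  have hcl : IsClosed {t | 1 ≤ ‖z t‖} := by
    simpa [compl_ofPred, not_lt] using h.isOpen_disc.isClosed_compl
  obtain ⟨a, ⟨ha, ha1⟩, hmax⟩ := (isCompact_Icc (a := s) (b := r)).inter_right hcl
    |>.exists_isGreatest ⟨s, left_mem_Icc.2 hsr, hs⟩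
  have har : a < r := lt_of_le_of_ne ha.2 fun h => (h ▸ hr).not_ge ha1
  have hin : ∀ x ∈ Ioc a r, ‖z x‖ < 1 := fun x hx => by
    by_contra hcon
    exact (hmax ⟨⟨ha.1.trans hx.1.le, hx.2⟩, not_lt.1 hcon⟩).not_gt hx.1
  refine ⟨a, ha.1, har, le_antisymm ?_ ha1, hin⟩
  have h1 : Ioc a r ⊆ {t | ‖z t‖ ≤ 1} := fun x hx => (hin x hx).le
  have h2 := h.isClosed_disc.closure_subset_iff.2 h1
  rw [closure_Ioc har.ne] at h2
  exact h2 (left_mem_Icc.2 har.le)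

/-- The first time after `r` at which the curve is not in the open disc. -/
theorem exists_first_exit (h : CrossesEdges n z τ) {r t : ℝ} (hrt : r ≤ t) (hr : ‖z r‖ < 1)
    (ht : 1 ≤ ‖z t‖) : ∃ b, r < b ∧ b ≤ t ∧ ‖z b‖ = 1 ∧ ∀ x ∈ Ico r b, ‖z x‖ < 1 := by
  have hcl : IsClosed {t | 1 ≤ ‖z t‖} := by
    simpa [compl_ofPred, not_lt] using h.isOpen_disc.isClosed_compl
  obtain ⟨b, ⟨hb, hb1⟩, hmin⟩ := (isCompact_Icc (a := r) (b := t)).inter_right hcl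
    |>.exists_isLeast ⟨t, right_mem_Icc.2 hrt, ht⟩
  have hrb : r < b := lt_of_le_of_ne hb.1 fun h => (h ▸ hr).not_ge hb1
  have hin : ∀ x ∈ Ico r b, ‖z x‖ < 1 := fun x hx => by
    by_contra hcon
    exact (hmin ⟨⟨hx.1, hx.2.le.trans hb.2⟩, not_lt.1 hcon⟩).not_gt hx.2
  refine ⟨b, hrb, hb.2, le_antisymm ?_ hb1, hin⟩
  have h1 : Ico r b ⊆ {t | ‖z t‖ ≤ 1} := fun x hx => (hin x hx).le
  have h2 := h.isClosed_disc.closure_subset_iff.2 h1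
  rw [closure_Ico hrb.ne] at h2
  exact h2 (right_mem_Icc.2 hrb.le)

theorem card_cutSet [NeZero n] (h : CrossesEdges n z τ) (h3 : 3 ≤ n) (ho : Odd n) {t : ℝ}
    (ht : t ∈ Icc (0 : ℝ) 1) (hz : ‖z t‖ = 1) : (cutSet n (z t)).card = n / 2 :=
  card_cutSet_of_norm_eq_one h3 ho hz (h.side_ne_zero h3 ho ht hz.le (h.time_ne hz.ge))

/-- Between two times at which the curve is outside the open disc, it crosses a balanced set of
edges: it is made up of the differences of the extreme cut sets at the ends of each passage
through the disc. -/
theorem balanced_crossed [NeZero n] (h : CrossesEdges n z τ) (h3 : 3 ≤ n) (ho : Odd n)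
    {s t : ℝ} (hs0 : 0 ≤ s) (hst : s ≤ t) (ht1 : t ≤ 1) (hs : 1 ≤ ‖z s‖) (ht : 1 ≤ ‖z t‖) :
    Balanced (n / 2) (crossed τ s t) := by
  induction hN : (crossed τ s t).card using Nat.strong_induction_on generalizing s t with
  | _ N ih =>
    rcases (crossed τ s t).eq_empty_or_nonempty with he | ⟨j, hj⟩
    · rw [he]; exact balanced_empty
    have hj' := mem_crossed.1 hj
    obtain ⟨a, hsa, haj, ha, hain⟩ := h.exists_last_entry hj'.1.le hs (h.norm_lt j)
    obtain ⟨b, hjb, hbt, hb, hbin⟩ := h.exists_first_exit hj'.2.le (h.norm_lt j) ht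
    have hab := haj.trans hjb
    have h1 : crossed τ s t = crossed τ s a ∪ (crossed τ a b ∪ crossed τ b t) := by
      rw [crossed_union hsa (hab.le.trans hbt) (h.time_ne ha.ge),
        crossed_union hab.le hbt (h.time_ne hb.ge)]
    have hsub : crossed τ s a ⊂ crossed τ s t := by
      rw [Finset.ssubset_iff_of_subset (by rw [h1]; exact Finset.subset_union_left)]
      exact ⟨j, hj, fun h => (mem_crossed.1 h).2.not_gt haj⟩
    have hsub' : crossed τ b t ⊂ crossed τ s t := by
      rw [Finset.ssubset_iff_of_subset (by
        rw [h1]; exact Finset.subset_union_right.trans Finset.subset_union_right)]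
      exact ⟨j, hj, fun h => (mem_crossed.1 h).1.not_gt hjb⟩
    have hB1 := ih _ (hN ▸ Finset.card_lt_card hsub) hs0 hsa
      (hab.le.trans (hbt.trans ht1)) hs ha.ge rfl
    have hB2 := ih _ (hN ▸ Finset.card_lt_card hsub') (hs0.trans (hsa.trans hab.le)) hbt
      ht1 hb.ge ht rfl
    have hdisc : ∀ r ∈ Icc a b, ‖z r‖ ≤ 1 := fun r hr => by
      rcases le_total r (τ j) with hrj | hrj
      · rcases hr.1.eq_or_lt with rfl | h5
        · exact ha.le
        · exact (hain r ⟨h5, hrj⟩).le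
      · rcases hr.2.eq_or_lt with rfl | h5
        · exact hb.le
        · exact (hbin r ⟨hrj, h5⟩).le
    have ha01 : a ∈ Icc (0 : ℝ) 1 := ⟨hs0.trans hsa, hab.le.trans (hbt.trans ht1)⟩
    have hb01 : b ∈ Icc (0 : ℝ) 1 := ⟨hs0.trans (hsa.trans hab.le), hbt.trans ht1⟩
    have hB3 : Balanced (n / 2) (crossed τ a b) := by
      rw [h.crossed_eq_symmDiff h3 ho ha01.1 hab.le hb01.2 hdisc (h.time_ne ha.ge)
        (h.time_ne hb.ge)]
      obtain ⟨k, hk⟩ := ho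
      exact balanced_symmDiff (by lia) (indep_cutSet h3 ⟨k, hk⟩ ha.le)
        (h.card_cutSet h3 ⟨k, hk⟩ ha01 ha) (indep_cutSet h3 ⟨k, hk⟩ hb.le)
        (h.card_cutSet h3 ⟨k, hk⟩ hb01 hb)
    rw [h1]
    refine hB1.union (hB3.union hB2 (disjoint_crossed le_rfl)) ?_
    rw [Finset.disjoint_union_right]
    exact ⟨disjoint_crossed le_rfl, disjoint_crossed hab.le⟩

/-- The labels of the ends of a curve that crosses every edge once differ by one. -/
theorem stdLabel_sub [NeZero n] (h : CrossesEdges n z τ) (h3 : 3 ≤ n) (ho : Odd n) :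
    |stdLabel n (z 0) - stdLabel n (z 1)| = 1 := by
  have hn : n = 2 * (n / 2) + 1 := by
    obtain ⟨k, hk⟩ := ho; lia
  have hτ0 : ∀ j, τ j ≠ 0 := fun j => (h.time_mem j).1.ne'
  have hτ1 : ∀ j, τ j ≠ 1 := fun j => (h.time_mem j).2.ne
  have huniv : crossed τ 0 1 = Finset.univ := by
    ext j; simpa [mem_crossed] using h.time_mem j
  have hout : ∃ u ∈ Icc (0 : ℝ) 1, 1 ≤ ‖z u‖ := by
    by_contra hcon
    push Not at hcon
    have h1 := h.crossed_eq_symmDiff h3 ho le_rfl zero_le_one le_rfl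
      (fun r hr => (hcon r hr).le) hτ0 hτ1
    rw [huniv] at h1
    exact Indep.symmDiff_ne_univ hn (indep_cutSet h3 ho (hcon 0 (by simp)).le)
      (indep_cutSet h3 ho (hcon 1 (by simp)).le) h1.symm
  obtain ⟨u, hu, hzu⟩ := hout
  -- some extreme cut set, needed if an end of the curve is outside the disc
  obtain ⟨E, hE, hEk⟩ : ∃ E : Finset (ZMod n), Indep E ∧ E.card = n / 2 := by
    have h1 := h.time_mem 0
    rcases le_total u (τ 0) with h2 | h2
    · obtain ⟨a, hua, haj, ha, -⟩ := h.exists_last_entry h2 hzu (h.norm_lt 0)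
      exact ⟨_, indep_cutSet h3 ho ha.le,
        h.card_cutSet h3 ho ⟨hu.1.trans hua, (haj.trans h1.2).le⟩ ha⟩
    · obtain ⟨b, hjb, hbu, hb, -⟩ := h.exists_first_exit h2 (h.norm_lt 0) hzu
      exact ⟨_, indep_cutSet h3 ho hb.le,
        h.card_cutSet h3 ho ⟨(h1.1.trans hjb).le, hbu.trans hu.2⟩ hb⟩
  obtain ⟨a, I, C, ha0, hau, ha, hI, hC, hCk, hIC, hlI⟩ : ∃ (a : ℝ) (I C : Finset (ZMod n)),
      0 ≤ a ∧ a ≤ u ∧ 1 ≤ ‖z a‖ ∧ Indep I ∧ Indep C ∧ C.card = n / 2 ∧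
      crossed τ 0 a = symmDiff I C ∧ stdLabel n (z 0) = (n / 2 : ℕ) - I.card := by
    by_cases h0 : ‖z 0‖ < 1
    · obtain ⟨b, hb0, hbu, hb, hbin⟩ := h.exists_first_exit hu.1 h0 hzu
      refine ⟨b, cutSet n (z 0), cutSet n (z b), hb0.le, hbu, hb.ge, indep_cutSet h3 ho h0.le,
        indep_cutSet h3 ho hb.le, h.card_cutSet h3 ho ⟨hb0.le, hbu.trans hu.2⟩ hb,
        h.crossed_eq_symmDiff h3 ho le_rfl hb0.le (hbu.trans hu.2) (fun r hr => ?_) hτ0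
          (h.time_ne hb.ge), if_pos h0⟩
      rcases hr.2.eq_or_lt with rfl | h5
      · exact hb.le
      · exact (hbin r ⟨hr.1, h5⟩).le
    · refine ⟨0, E, E, le_rfl, hu.1, not_lt.1 h0, hE, hE, hEk, ?_, ?_⟩
      · rw [crossed_self, symmDiff_self, Finset.bot_eq_empty]
      · rw [stdLabel, if_neg h0, hEk, sub_self]
  obtain ⟨b, J, C', hub, hb1, hb, hJ, hC', hCk', hJC, hlJ⟩ : ∃ (b : ℝ) (J C' : Finset (ZMod n)),
      u ≤ b ∧ b ≤ 1 ∧ 1 ≤ ‖z b‖ ∧ Indep J ∧ Indep C' ∧ C'.card = n / 2 ∧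
      crossed τ b 1 = symmDiff J C' ∧ stdLabel n (z 1) = (n / 2 : ℕ) - J.card := by
    by_cases h0 : ‖z 1‖ < 1
    · obtain ⟨b, hub, hb1, hb, hbin⟩ := h.exists_last_entry hu.2 hzu h0
      refine ⟨b, cutSet n (z 1), cutSet n (z b), hub, hb1.le, hb.ge, indep_cutSet h3 ho h0.le,
        indep_cutSet h3 ho hb.le, h.card_cutSet h3 ho ⟨hu.1.trans hub, hb1.le⟩ hb, ?_, if_pos h0⟩
      rw [symmDiff_comm]
      refine h.crossed_eq_symmDiff h3 ho (hu.1.trans hub) hb1.le le_rfl (fun r hr => ?_)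
        (h.time_ne hb.ge) hτ1
      rcases hr.1.eq_or_lt with rfl | h5
      · exact hb.le
      · exact (hbin r ⟨h5, hr.2⟩).le
    · refine ⟨1, E, E, hu.2, le_rfl, not_lt.1 h0, hE, hE, hEk, ?_, ?_⟩
      · rw [crossed_self, symmDiff_self, Finset.bot_eq_empty]
      · rw [stdLabel, if_neg h0, hEk, sub_self]
  have hab := hau.trans hub
  rw [hlI, hlJ]
  refine label_sub_abs hn hI hJ hC hCk hC' hCk'
    (h.balanced_crossed h3 ho ha0 hab hb1 ha hb) ?_ ?_ ?_
  · rw [← hIC]; exact disjoint_crossed le_rfl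
  · rw [← hIC, ← hJC, Finset.disjoint_union_left]
    exact ⟨disjoint_crossed hab, disjoint_crossed le_rfl⟩
  · rw [← hIC, ← hJC, ← crossed_union ha0 hab (h.time_ne ha),
      ← crossed_union (ha0.trans hab) hb1 (h.time_ne hb), huniv]

end CrossesEdges

/-! ### Rotation numbers and homeomorphisms of the sphere -/

open Filter Topology OnePoint in
/-- The inversion `z ↦ 1 / z` of the Riemann sphere. -/
def sphereInv : OnePoint ℂ ≃ₜ OnePoint ℂ :=
  let f : OnePoint ℂ → OnePoint ℂ := fun x =>
    x.elim ((0 : ℂ) : OnePoint ℂ) fun z =>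
      open Classical in if z = 0 then ∞ else ((z⁻¹ : ℂ) : OnePoint ℂ)
  have hf : Function.Involutive f := by
    intro x
    cases x with
    | infty => simp [f]
    | coe z => by_cases hz : z = 0 <;> simp [f, hz]
  have hc : Continuous f := by
    rw [OnePoint.continuous_iff, coclosedCompact_eq_cocompact, ← Metric.cobounded_eq_cocompact]
    constructor
    · have h1 : Tendsto (fun z : ℂ => ((z⁻¹ : ℂ) : OnePoint ℂ)) (Bornology.cobounded ℂ)
          (𝓝 ((0 : ℂ) : OnePoint ℂ)) :=
        (OnePoint.continuous_coe.tendsto 0).comp tendsto_inv₀_cobounded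
      refine h1.congr' ?_
      filter_upwards [Bornology.eventually_ne_cobounded (0 : ℂ)] with z hz
      simp [f, hz]
    · rw [continuous_iff_continuousAt]
      intro z
      by_cases hz : z = 0
      · subst hz
        have h0 : f ((0 : ℂ) : OnePoint ℂ) = ∞ := by simp [f]
        rw [continuousAt_iff_punctured_nhds, h0]
        have h1 : Tendsto (fun z : ℂ => ((z⁻¹ : ℂ) : OnePoint ℂ)) (𝓝[≠] 0) (𝓝 ∞) := by
          refine OnePoint.tendsto_coe_infty.comp ?_
          rw [coclosedCompact_eq_cocompact, ← Metric.cobounded_eq_cocompact]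
          exact tendsto_inv₀_nhdsNE_zero
        refine h1.congr' ?_
        filter_upwards [self_mem_nhdsWithin] with z hz
        simp [f, show z ≠ 0 from hz]
      · have h1 : ContinuousAt (fun z : ℂ => ((z⁻¹ : ℂ) : OnePoint ℂ)) z :=
          OnePoint.continuous_coe.continuousAt.comp (continuousAt_inv₀ hz)
        refine h1.congr ?_
        filter_upwards [isOpen_ne.mem_nhds hz] with w hw
        simp [f, show w ≠ 0 from hw]
  { toEquiv := hf.toPerm
    continuous_toFun := hc
    continuous_invFun := hc }

theorem sphereInv_infty : sphereInv OnePoint.infty = ((0 : ℂ) : OnePoint ℂ) := rfl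

theorem sphereInv_zero : sphereInv ((0 : ℂ) : OnePoint ℂ) = OnePoint.infty := if_pos rfl

theorem sphereInv_coe {z : ℂ} (hz : z ≠ 0) :
    sphereInv (z : OnePoint ℂ) = ((z⁻¹ : ℂ) : OnePoint ℂ) := if_neg hz

/-- The translation by `-a`, as a homeomorphism of the sphere. -/
def sphereSub (a : ℂ) : OnePoint ℂ ≃ₜ OnePoint ℂ := (Homeomorph.subRight a).onePointCongr

theorem sphereSub_coe (a z : ℂ) :
    sphereSub a (z : OnePoint ℂ) = ((z - a : ℂ) : OnePoint ℂ) := rfl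

theorem sphereSub_infty (a : ℂ) : sphereSub a OnePoint.infty = OnePoint.infty := rfl

/-- The rotation number of the plane curve `f` around the point `x` of the sphere is `k`; the
rotation number around `∞` is `0`. -/
def HasIndex (f : ℝ → ℂ) (L : ℝ) (x : OnePoint ℂ) (k : ℤ) : Prop :=
  x.elim (k = 0) fun p => HasWinding (fun t => f t - p) L k

/-- A Möbius transformation that moves `P` to `0` and `Q` to `∞` turns the difference of the
rotation numbers around `P` and `Q` into the rotation number around `0`. -/
theorem exists_moebius {P Q : OnePoint ℂ} (hPQ : P ≠ Q) :
    ∃ m : OnePoint ℂ ≃ₜ OnePoint ℂ, m P = ((0 : ℂ) : OnePoint ℂ) ∧ m Q = OnePoint.infty ∧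
      ∀ (f : ℝ → ℂ) (L : ℝ) (k l : ℤ), HasIndex f L P k → HasIndex f L Q l →
        ∃ F : ℝ → ℂ, (∀ t, m (f t : OnePoint ℂ) = (F t : OnePoint ℂ)) ∧
          HasWinding F L (k - l) := by
  have hne : ∀ {f : ℝ → ℂ} {L : ℝ} {p : ℂ} {k : ℤ}, HasWinding (fun t => f t - p) L k →
      ∀ t, f t - p ≠ 0 := by
    rintro f L p k ⟨g, -, hg, -⟩ t h0
    exact Complex.exp_ne_zero _ ((hg t).symm.trans h0)
  cases Q with
  | infty =>
    cases P with
    | infty => exact absurd rfl hPQ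
    | coe p =>
      refine ⟨sphereSub p, by rw [sphereSub_coe, sub_self], sphereSub_infty p,
        fun f L k l hk hl => ⟨fun t => f t - p, fun t => sphereSub_coe p _, ?_⟩⟩
      have hl' : l = 0 := hl
      rw [hl', sub_zero]
      exact hk
  | coe q =>
    have hq0 : sphereInv (sphereSub q (q : OnePoint ℂ)) = OnePoint.infty := by
      rw [sphereSub_coe, sub_self, sphereInv_zero]
    cases P with
    | infty =>
      refine ⟨(sphereSub q).trans sphereInv, ?_, hq0,
        fun f L k l hk hl => ⟨fun t => (f t - q)⁻¹, fun t => ?_, ?_⟩⟩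
      · rw [Homeomorph.trans_apply, sphereSub_infty, sphereInv_infty]
      · rw [Homeomorph.trans_apply, sphereSub_coe, sphereInv_coe (hne hl t)]
      · have hk' : k = 0 := hk
        rw [hk', zero_sub]
        exact HasWinding.inv hl
    | coe p =>
      have hpq : p - q ≠ 0 := fun h => hPQ (by rw [sub_eq_zero.1 h])
      refine ⟨((sphereSub q).trans sphereInv).trans (sphereSub (p - q)⁻¹), ?_, ?_,
        fun f L k l hk hl => ⟨fun t => (f t - q)⁻¹ - (p - q)⁻¹, fun t => ?_, ?_⟩⟩
      · rw [Homeomorph.trans_apply, Homeomorph.trans_apply, sphereSub_coe, sphereInv_coe hpq,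
          sphereSub_coe, sub_self]
      · rw [Homeomorph.trans_apply, Homeomorph.trans_apply, hq0, sphereSub_infty]
      · rw [Homeomorph.trans_apply, Homeomorph.trans_apply, sphereSub_coe,
          sphereInv_coe (hne hl t), sphereSub_coe]
      · have h1 := (HasWinding.mul hk (HasWinding.inv hl)).mul
          (HasWinding.const (neg_ne_zero.2 (inv_ne_zero hpq)) L)
        rw [add_zero, ← sub_eq_add_neg] at h1
        convert h1 using 2 with t
        have := hne hl t
        field_simp
        ring

/-- The finite points of the sphere as complex numbers. The value `2` at `∞` is a convention that
keeps `∞` apart from the closed unit disc. -/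
def finitePart (x : OnePoint ℂ) : ℂ := x.elim 2 id

@[simp] theorem finitePart_coe (z : ℂ) : finitePart (z : OnePoint ℂ) = z := rfl

theorem coe_finitePart {x : OnePoint ℂ} (hx : x ≠ OnePoint.infty) :
    (finitePart x : OnePoint ℂ) = x := by
  cases x with
  | infty => exact absurd rfl hx
  | coe z => rfl

theorem continuousOn_finitePart : ContinuousOn finitePart {OnePoint.infty}ᶜ := by
  intro x hx
  cases x with
  | infty => exact absurd rfl hx
  | coe z =>
    have h1 : ContinuousAt (finitePart ∘ ((↑) : ℂ → OnePoint ℂ)) z := by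
      change ContinuousAt id z
      exact continuousAt_id
    exact (OnePoint.continuousAt_coe.2 h1).continuousWithinAt

/-- Up to a sign, a homeomorphism of the sphere preserves the difference of the rotation numbers
around two points. -/
theorem abs_index_sub_eq (h : OnePoint ℂ ≃ₜ OnePoint ℂ) {S T : ℝ → ℂ}
    (hST : ∀ t, (T t : OnePoint ℂ) = h (S t : OnePoint ℂ)) {L : ℝ} {P Q : OnePoint ℂ}
    (hPQ : P ≠ Q) {k l a b : ℤ} (hk : HasIndex S L P k) (hl : HasIndex S L Q l)
    (ha : HasIndex T L (h P) a) (hb : HasIndex T L (h Q) b) : |a - b| = |k - l| := by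
  obtain ⟨m, hmP, hmQ, hm⟩ := exists_moebius hPQ
  obtain ⟨m', hmP', hmQ', hm'⟩ := exists_moebius (h.injective.ne hPQ)
  obtain ⟨F, hF, hFw⟩ := hm S L k l hk hl
  obtain ⟨G, hG, hGw⟩ := hm' T L a b ha hb
  -- the homeomorphism in the coordinates in which both pairs of points are `0, ∞`
  set u : OnePoint ℂ ≃ₜ OnePoint ℂ := (m.symm.trans h).trans m' with hu
  have hu0 : u ((0 : ℂ) : OnePoint ℂ) = ((0 : ℂ) : OnePoint ℂ) := by
    rw [hu, Homeomorph.trans_apply, Homeomorph.trans_apply, m.symm_apply_eq.2 hmP.symm, hmP']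
  have hui : u OnePoint.infty = OnePoint.infty := by
    rw [hu, Homeomorph.trans_apply, Homeomorph.trans_apply, m.symm_apply_eq.2 hmQ.symm, hmQ']
  have key : ∀ v : OnePoint ℂ ≃ₜ OnePoint ℂ, v ((0 : ℂ) : OnePoint ℂ) = ((0 : ℂ) : OnePoint ℂ) →
      v OnePoint.infty = OnePoint.infty →
      (∀ z : ℂ, (finitePart (v z) : OnePoint ℂ) = v z) ∧
      ContinuousOn (fun z : ℂ => finitePart (v z)) {0}ᶜ ∧
      ∀ z : ℂ, z ≠ 0 → finitePart (v z) ≠ 0 := by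
    intro v hv0 hvi
    have hfin : ∀ z : ℂ, v z ≠ OnePoint.infty := fun z hz =>
      OnePoint.coe_ne_infty z (v.injective (hz.trans hvi.symm))
    refine ⟨fun z => coe_finitePart (hfin z), ?_, fun z hz h0 => hz ?_⟩
    · exact (continuousOn_finitePart.comp_continuous
        (v.continuous.comp OnePoint.continuous_coe) hfin).continuousOn
    · have h1 := coe_finitePart (hfin z)
      rw [h0, ← hv0] at h1
      exact (OnePoint.coe_eq_coe.1 (v.injective h1)).symm
  obtain ⟨hu1, hu2, hu3⟩ := key u hu0 hui
  obtain ⟨hv1, hv2, hv3⟩ := key u.symm (by rw [Homeomorph.symm_apply_eq, hu0])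
    (by rw [Homeomorph.symm_apply_eq, hui])
  obtain ⟨d, hd, hdeg⟩ := exists_sign_of_homeo hu2 hv2 hu3 hv3 (fun z _ => by
    rw [hu1, Homeomorph.symm_apply_apply, finitePart_coe])
  have h1 := hdeg F L _ hFw
  have h2 : (fun t => finitePart (u (F t))) = G := by
    funext t
    rw [← hF, hu, Homeomorph.trans_apply, Homeomorph.trans_apply, Homeomorph.symm_apply_apply,
      ← hST, hG, finitePart_coe]
  rw [h2] at h1
  rw [hGw.unique h1, abs_mul, hd, one_mul]

/-! ### Proper crossings -/

theorem mul_neg_of_continuousOn_of_injOn {ψ : ℝ → ℝ} {s r t : ℝ} (hsr : s < r) (hrt : r < t)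
    (hψ : ContinuousOn ψ (Icc s t)) (hinj : InjOn ψ (Icc s t)) (h0 : ψ r = 0) :
    ψ s * ψ t < 0 := by
  have hst := hsr.trans hrt
  have hs : s ∈ Icc s t := left_mem_Icc.2 hst.le
  have ht : t ∈ Icc s t := right_mem_Icc.2 hst.le
  have hr : r ∈ Icc s t := ⟨hsr.le, hrt.le⟩
  rcases hψ.strictMonoOn_of_injOn_Icc' hst.le hinj with h | h
  · have h1 := h hs hr hsr
    have h2 := h hr ht hrt
    rw [h0] at h1 h2
    exact mul_neg_of_neg_of_pos h1 h2
  · have h1 := h hs hr hsr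
    have h2 := h hr ht hrt
    rw [h0] at h1 h2
    exact mul_neg_of_pos_of_neg h1 h2

theorem side_add_mul_chordDir (n : ℕ) (j : ℤ) (p : ℂ) (a : ℝ) :
    side n j (p + a * chordDir n j) = side n j p + a := by
  unfold side
  rw [add_mul, mul_assoc, chordDir_mul_conj, mul_one, Complex.add_re, Complex.ofReal_re]
  ring

/-- A line through a point of an open set has points of the set on both of its sides. -/
theorem exists_side_neg_and_pos {n : ℕ} {j : ℤ} {O : Set ℂ} (hO : IsOpen O) {p : ℂ} (hp : p ∈ O)
    (h0 : side n j p = 0) : (∃ x ∈ O, side n j x < 0) ∧ ∃ x ∈ O, 0 < side n j x := by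
  have hc : Continuous fun a : ℝ => p + a * chordDir n j := by fun_prop
  obtain ⟨ε, hε, hball⟩ := Metric.isOpen_iff.1 (hO.preimage hc) 0 (by simpa using hp)
  have hmem : ∀ a : ℝ, |a| < ε → p + a * chordDir n j ∈ O := fun a ha => hball (by simpa using ha)
  constructor
  · refine ⟨_, hmem (-(ε / 2)) (by rw [abs_neg, abs_of_pos] <;> linarith), ?_⟩
    rw [side_add_mul_chordDir, h0]; linarith
  · refine ⟨_, hmem (ε / 2) (by rw [abs_of_pos] <;> linarith), ?_⟩
    rw [side_add_mul_chordDir, h0]; linarith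

/-- Let `G` be continuous on a ball around `0` and vanish exactly on the imaginary axis. Then `G`
has a constant sign on each half of the ball, and the signs differ as soon as `G` takes both signs. -/
theorem mul_neg_of_half_balls {G : ℂ → ℝ} {δ : ℝ} (hG : ContinuousOn G (Metric.ball 0 δ))
    (h0 : ∀ w ∈ Metric.ball (0 : ℂ) δ, G w = 0 ↔ w.re = 0)
    (hneg : ∃ w ∈ Metric.ball (0 : ℂ) δ, G w < 0) (hpos : ∃ w ∈ Metric.ball (0 : ℂ) δ, 0 < G w)
    {w w' : ℂ} (hw : w ∈ Metric.ball (0 : ℂ) δ) (hw' : w' ∈ Metric.ball (0 : ℂ) δ)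
    (hww' : w.re * w'.re < 0) : G w * G w' < 0 := by
  have hsame : ∀ v ∈ Metric.ball (0 : ℂ) δ, ∀ v' ∈ Metric.ball (0 : ℂ) δ, 0 < v.re * v'.re →
      0 < G v * G v' := by
    intro v hv v' hv' hvv'
    have hseg : segment ℝ v v' ⊆ Metric.ball 0 δ := (convex_ball 0 δ).segment_subset hv hv'
    have hline : Icc (0 : ℝ) 1 ⊆ (fun s : ℝ => AffineMap.lineMap (k := ℝ) v v' s) ⁻¹'
        Metric.ball 0 δ := fun s hs => hseg (by
      rw [segment_eq_image_lineMap]; exact ⟨s, hs, rfl⟩)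
    have h1 := mul_pos_of_continuousOn_of_ne_zero zero_le_one
      (hG.comp (f := fun s : ℝ => AffineMap.lineMap (k := ℝ) v v' s)
        (Continuous.continuousOn (by fun_prop)) hline) fun s hs hs0 => by
      have h2 := (h0 _ (hline hs)).1 hs0
      have h4 : (AffineMap.lineMap (k := ℝ) v v' s : ℂ).re = (1 - s) * v.re + s * v'.re := by
        rw [AffineMap.lineMap_apply]
        simp only [vsub_eq_sub, vadd_eq_add, Complex.real_smul, Complex.add_re,
          Complex.re_ofReal_mul, Complex.sub_re]
        ring
      rw [h4] at h2
      rcases mul_pos_iff.1 hvv' with ⟨ha, hb⟩ | ⟨ha, hb⟩ <;>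
      · rcases hs.1.eq_or_lt with rfl | hs1
        · linarith
        · nlinarith [hs.2]
    simpa using h1
  obtain ⟨a, ha, hGa⟩ := hneg
  obtain ⟨b, hb, hGb⟩ := hpos
  have ha0 : a.re ≠ 0 := fun h => hGa.ne ((h0 a ha).2 h)
  have hb0 : b.re ≠ 0 := fun h => hGb.ne' ((h0 b hb).2 h)
  have hab : a.re * b.re < 0 := by
    by_contra hcon
    have := hsame a ha b hb (lt_of_le_of_ne (not_lt.1 hcon) (mul_ne_zero ha0 hb0).symm)
    nlinarith
  have hcase : (0 < a.re * w.re ∧ 0 < b.re * w'.re) ∨ (0 < b.re * w.re ∧ 0 < a.re * w'.re) := by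
    rcases mul_neg_iff.1 hab with ⟨h1, h2⟩ | ⟨h1, h2⟩ <;>
    rcases mul_neg_iff.1 hww' with ⟨h4, h5⟩ | ⟨h4, h5⟩
    · exact Or.inl ⟨mul_pos h1 h4, mul_pos_of_neg_of_neg h2 h5⟩
    · exact Or.inr ⟨mul_pos_of_neg_of_neg h2 h4, mul_pos h1 h5⟩
    · exact Or.inr ⟨mul_pos h2 h4, mul_pos_of_neg_of_neg h1 h5⟩
    · exact Or.inl ⟨mul_pos_of_neg_of_neg h1 h4, mul_pos h2 h5⟩
  rcases hcase with ⟨h1, h2⟩ | ⟨h1, h2⟩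
  · have h4 := neg_of_mul_pos_right (hsame a ha w hw h1) hGa.le
    have h5 := pos_of_mul_pos_right (hsame b hb w' hw' h2) hGb.le
    exact mul_neg_of_neg_of_pos h4 h5
  · have h4 := pos_of_mul_pos_right (hsame b hb w hw h1) hGb.le
    have h5 := neg_of_mul_pos_right (hsame a ha w' hw' h2) hGa.le
    exact mul_neg_of_pos_of_neg h4 h5

theorem ne_infty_of_norm_finitePart_le {x : OnePoint ℂ} (hx : ‖finitePart x‖ ≤ 1) :
    x ≠ OnePoint.infty := by
  rintro rfl
  have : ‖(2 : ℂ)‖ ≤ 1 := hx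
  norm_num at this

theorem setOf_norm_finitePart_lt :
    {x : OnePoint ℂ | ‖finitePart x‖ < 1} = (↑) '' Metric.ball (0 : ℂ) 1 := by
  ext x
  constructor
  · intro hx
    exact ⟨finitePart x, by simpa using hx,
      coe_finitePart (ne_infty_of_norm_finitePart_le (le_of_lt hx))⟩
  · rintro ⟨z, hz, rfl⟩
    simpa using hz

theorem setOf_norm_finitePart_le :
    {x : OnePoint ℂ | ‖finitePart x‖ ≤ 1} = (↑) '' Metric.closedBall (0 : ℂ) 1 := by
  ext x
  constructor
  · intro hx
    exact ⟨finitePart x, by simpa using hx, coe_finitePart (ne_infty_of_norm_finitePart_le hx)⟩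
  · rintro ⟨z, hz, rfl⟩
    simpa using hz

theorem isOpen_norm_finitePart_lt : IsOpen {x : OnePoint ℂ | ‖finitePart x‖ < 1} := by
  rw [setOf_norm_finitePart_lt]
  exact OnePoint.isOpenMap_coe _ Metric.isOpen_ball

theorem isClosed_norm_finitePart_le : IsClosed {x : OnePoint ℂ | ‖finitePart x‖ ≤ 1} := by
  rw [setOf_norm_finitePart_le]
  exact ((isCompact_closedBall 0 1).image OnePoint.continuous_coe).isClosed

/-- A curve that crosses the image under `h` of a chord properly changes the side of the chord: the
chart of the crossing maps the two half-neighbourhoods of the chord to the two half-planes. -/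
theorem ProperCrossing.flip {n : ℕ} (h3 : 3 ≤ n) (ho : Odd n) (h : OnePoint ℂ ≃ₜ OnePoint ℂ)
    {j : ℤ} {E : Set ℂ}
    (hE : ∀ v : ℂ, v ∈ E ↔ finitePart (h.symm v) ∈ stdCurve n '' Icc (j : ℝ) (j + 1))
    {γ : ℝ → ℂ} (hγ : Continuous γ) {r : ℝ} (hinj : InjOn γ (Icc 0 1)) (hr : r ∈ Ioo (0 : ℝ) 1)
    (hrE : γ r ∈ E) (hnorm : ‖finitePart (h.symm (γ r))‖ < 1)
    (hcross : ProperCrossing (range γ) E (γ r)) :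
    ∃ ε > 0, ∀ s ∈ Ioo (r - ε) r, ∀ t ∈ Ioo r (r + ε),
      side n j (finitePart (h.symm (γ s))) * side n j (finitePart (h.symm (γ t))) < 0 := by
  obtain ⟨φ, hsrc, hφ0, hφ⟩ := hcross
  set Ψ : ℂ → ℂ := fun v => finitePart (h.symm v) with hΨ
  have hNo : IsOpen {v : ℂ | ‖Ψ v‖ < 1} :=
    isOpen_norm_finitePart_lt.preimage (h.symm.continuous.comp OnePoint.continuous_coe)
  have hΨc : ContinuousOn Ψ {v : ℂ | ‖Ψ v‖ < 1} :=
    continuousOn_finitePart.comp (h.symm.continuous.comp OnePoint.continuous_coe).continuousOn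
      fun v hv => ne_infty_of_norm_finitePart_le (le_of_lt hv)
  obtain ⟨δ, hδ, hball⟩ := Metric.isOpen_iff.1 (φ.isOpen_inter_preimage_symm hNo) 0
    ⟨hφ0 ▸ φ.map_source hsrc, by
      change ‖Ψ (φ.symm 0)‖ < 1
      rw [← hφ0, φ.left_inv hsrc]; exact hnorm⟩
  set G : ℂ → ℝ := fun w => side n j (Ψ (φ.symm w)) with hG
  have hGc : ContinuousOn G (Metric.ball 0 δ) :=
    (continuous_side n j).comp_continuousOn (hΨc.comp
      (φ.continuousOn_symm.mono fun w hw => (hball hw).1) fun w hw => (hball hw).2)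
  have hG0 : ∀ w ∈ Metric.ball (0 : ℂ) δ, G w = 0 ↔ w.re = 0 := by
    intro w hw
    have h1 := (hφ _ (φ.map_target (hball hw).1)).2
    rw [φ.right_inv (hball hw).1, hE] at h1
    rw [← h1]
    constructor
    · exact mem_edge_of_side_eq_zero h3 ho (le_of_lt (hball hw).2)
    · rintro ⟨t, ht, htw⟩
      change side n j (finitePart _) = 0
      rw [← htw, side_stdCurve n j ht]
  -- the part of the source of the chart that is mapped to the ball, moved back by `h`
  have hOo : IsOpen {x : ℂ |
      h x ∈ ((↑) '' (φ.source ∩ φ ⁻¹' Metric.ball 0 δ) : Set (OnePoint ℂ))} :=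
    (OnePoint.isOpenMap_coe _ (φ.isOpen_inter_preimage Metric.isOpen_ball)).preimage
      (h.continuous.comp OnePoint.continuous_coe)
  have hcoe : ((finitePart (h.symm (γ r)) : ℂ) : OnePoint ℂ) = h.symm (γ r) :=
    coe_finitePart (ne_infty_of_norm_finitePart_le hnorm.le)
  have hside0 : side n j (Ψ (γ r)) = 0 := by
    obtain ⟨t, ht, htw⟩ := (hE _).1 hrE
    change side n j (finitePart _) = 0
    rw [← htw, side_stdCurve n j ht]
  have hGO : ∀ x : ℂ, h x ∈ ((↑) '' (φ.source ∩ φ ⁻¹' Metric.ball 0 δ) : Set (OnePoint ℂ)) →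
      ∃ w ∈ Metric.ball (0 : ℂ) δ, G w = side n j x := by
    rintro x ⟨v, ⟨hv, hvb⟩, hvx⟩
    refine ⟨φ v, hvb, ?_⟩
    change side n j (finitePart (h.symm (φ.symm (φ v)))) = _
    rw [φ.left_inv hv, hvx, Homeomorph.symm_apply_apply, finitePart_coe]
  obtain ⟨⟨x, hx, hxn⟩, ⟨y, hy, hyp⟩⟩ := exists_side_neg_and_pos (n := n) (j := j) hOo
    (p := Ψ (γ r)) ⟨γ r, ⟨hsrc, by simp [hφ0, hδ]⟩, by
      change _ = h (finitePart (h.symm (γ r)) : ℂ)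
      rw [hcoe, Homeomorph.apply_symm_apply]⟩ hside0
  obtain ⟨a, ha, hGa⟩ := hGO x hx
  obtain ⟨b, hb, hGb⟩ := hGO y hy
  have hflip := fun {w w' : ℂ} => mul_neg_of_half_balls (w := w) (w' := w') hGc hG0
    ⟨a, ha, hGa ▸ hxn⟩ ⟨b, hb, hGb ▸ hyp⟩
  -- in the chart, the curve moves injectively along the real axis
  obtain ⟨ε, hε, hεsub⟩ := Metric.isOpen_iff.1
    ((isOpen_Ioo (a := (0 : ℝ)) (b := 1)).inter
      ((φ.isOpen_inter_preimage (Metric.isOpen_ball (x := (0 : ℂ)) (ε := δ))).preimage hγ)) r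
    ⟨hr, hsrc, by simp [hφ0, hδ]⟩
  rw [Real.ball_eq_Ioo] at hεsub
  refine ⟨ε, hε, fun s hs t ht => ?_⟩
  have hIcc : Icc s t ⊆ Ioo (r - ε) (r + ε) := fun x hx =>
    ⟨hs.1.trans_le hx.1, hx.2.trans_lt ht.2⟩
  have hsub : ∀ x ∈ Icc s t, x ∈ Ioo (0 : ℝ) 1 ∧ γ x ∈ φ.source ∧ φ (γ x) ∈ Metric.ball (0 : ℂ) δ :=
    fun x hx => hεsub (hIcc hx)
  have hst : s ≤ t := (hs.2.trans ht.1).le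
  have hreal : ∀ x ∈ Icc s t, (φ (γ x)).im = 0 := fun x hx =>
    (hφ _ (hsub x hx).2.1).1.1 (mem_range_self x)
  have hneg := mul_neg_of_continuousOn_of_injOn (ψ := fun x => (φ (γ x)).re) hs.2 ht.1
    (Complex.continuous_re.comp_continuousOn
      (φ.continuousOn.comp hγ.continuousOn fun x hx => (hsub x hx).2.1))
    (fun x hx y hy hxy => hinj (Ioo_subset_Icc_self (hsub x hx).1)
      (Ioo_subset_Icc_self (hsub y hy).1) (φ.injOn (hsub x hx).2.1 (hsub y hy).2.1
        (Complex.ext hxy ((hreal x hx).trans (hreal y hy).symm))))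
    (by simp only [hφ0, Complex.zero_re])
  have hs' := hsub s (left_mem_Icc.2 hst)
  have ht' := hsub t (right_mem_Icc.2 hst)
  have := hflip hs'.2.2 ht'.2.2 hneg
  simp only [hG, φ.left_inv hs'.2.1, φ.left_inv ht'.2.1] at this
  exact this

/-! ### Domains and labels -/

theorem HasWinding.hasRotationNumber {T : ℝ → ℂ} {L : ℝ} {p : ℂ} {k : ℤ}
    (hk : HasWinding (fun t => T t - p) L k) : HasRotationNumber T L p k := by
  obtain ⟨g, hg, hTg, hgL⟩ := hk
  refine ⟨?_, fun t => (g t).im, (Complex.continuous_im.comp hg).continuousOn, fun t _ => ?_, ?_⟩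
  · rintro ⟨t, -, ht⟩
    exact Complex.exp_ne_zero _ ((hTg t).symm.trans (sub_eq_zero.2 ht))
  · have h1 := hTg t
    simp only at h1
    rw [h1, Complex.norm_exp, Complex.ofReal_exp, ← Complex.exp_add, Complex.re_add_im]
  · have := congrArg Complex.im hgL
    simp only [Complex.sub_im] at this
    rw [this]
    simp
    ring

/-- A closed curve has the same rotation number around all points of a domain. -/
theorem exists_isDomainWithLabel {n : ℕ} {T : ℝ → ℂ} (hT : Continuous T) (hL : T n = T 0)
    (hrange : range T = T '' Icc 0 (n : ℝ)) {p : ℂ} (hp : p ∉ range T) :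
    ∃ (D : Set ℂ) (k : ℤ), p ∈ D ∧ IsDomainWithLabel n T D k ∧
      HasWinding (fun t => T t - p) n k := by
  have hcomp : IsCompact (range T) := by
    rw [hrange]; exact isCompact_Icc.image hT
  have hex : ∀ q : ℂ, ∃ k : ℤ, q ∉ range T → HasWinding (fun t => T t - q) n k := by
    intro q
    by_cases hq : q ∈ range T
    · exact ⟨0, fun h => absurd hq h⟩
    · obtain ⟨k, hk⟩ := HasWinding.exists (f := fun t => T t - q) (L := n) (by fun_prop)
        (fun t ht => hq ⟨t, sub_eq_zero.1 ht⟩) (by rw [hL])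
      exact ⟨k, fun _ => hk⟩
  choose K hK using hex
  have hKc : ContinuousOn K (range T)ᶜ := by
    intro q hq
    refine ContinuousAt.continuousWithinAt ?_
    rw [ContinuousAt, nhds_discrete ℤ, Filter.tendsto_pure]
    filter_upwards [(hK q hq).eventually_nhds hT hL hcomp,
      hcomp.isClosed.isOpen_compl.mem_nhds hq] with q' hq' hq''
    exact (hK q' hq'').unique hq'
  refine ⟨connectedComponentIn (range T)ᶜ p, K p, mem_connectedComponentIn hp,
    ⟨⟨p, by rwa [← hrange], by rw [hrange]⟩, fun q hq => ?_⟩, hK p hp⟩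
  rw [isPreconnected_connectedComponentIn.constant
    (hKc.mono (connectedComponentIn_subset _ _)) (mem_connectedComponentIn hp) hq]
  exact (hK q (connectedComponentIn_subset _ _ hq)).hasRotationNumber

theorem hasIndex_stdLabel {n : ℕ} [NeZero n] (h3 : 3 ≤ n) (ho : Odd n) {x : OnePoint ℂ}
    (hx : ∀ t, (stdCurve n t : OnePoint ℂ) ≠ x) :
    HasIndex (stdCurve n) n x (stdLabel n (finitePart x)) := by
  cases x with
  | infty =>
    have h2 : ¬ ‖finitePart OnePoint.infty‖ < 1 := fun h =>
      ne_infty_of_norm_finitePart_le h.le rfl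
    exact if_neg h2
  | coe p =>
    change HasWinding _ _ (stdLabel n p)
    have hp : ∀ t, stdCurve n t ≠ p := fun t ht => hx t (by rw [ht])
    rw [stdLabel]
    split_ifs with h1
    · refine hasWinding_disc h3 ho h1 fun j hj => ?_
      obtain ⟨t, -, ht⟩ := mem_edge_of_side_eq_zero h3 ho h1.le hj
      exact hp t ht
    · exact hasWinding_outside h3 (not_lt.1 h1) hp

end Thrackle

end

theorem lemma1 (n : ℕ) (T : ℝ → ℂ) (hT : Thrackle.IsStandardMusquash n T)
    (A B : ℂ) (γ : Path A B) (hγ : Function.Injective γ)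
    (hvert : ∀ j : ℕ, j < n → T (j : ℝ) ∉ Set.range γ)
    (hcross : ∀ j : ℕ, j < n → Thrackle.CrossesOnce γ (Thrackle.edge T j)) :
    ∃ (D₁ D₂ : Set ℂ) (k₁ k₂ : ℤ),
      A ∈ D₁ ∧ B ∈ D₂ ∧
      Thrackle.IsDomainWithLabel n T D₁ k₁ ∧ Thrackle.IsDomainWithLabel n T D₂ k₂ ∧
      |k₁ - k₂| = 1 := by
  open Thrackle in
  obtain ⟨h3, ho, h, hh⟩ := hT
  have : NeZero n := ⟨by lia⟩
  have hTc : Continuous T := by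
    rw [OnePoint.isOpenEmbedding_coe.isEmbedding.continuous_iff]
    have : ((↑) : ℂ → OnePoint ℂ) ∘ T = fun t => h (stdCurve n t : OnePoint ℂ) := funext hh
    rw [this]
    exact h.continuous.comp (OnePoint.continuous_coe.comp (continuous_stdCurve n))
  have hper : ∀ (t : ℝ) (m : ℤ), T (t + (n * m : ℤ)) = T t := fun t m =>
    OnePoint.coe_injective (by rw [hh, hh, stdCurve_add_period h3])
  have hTL : T n = T 0 := by
    have := hper 0 1
    simpa using this
  have hrange : range T = T '' Icc 0 (n : ℝ) := by
    refine Subset.antisymm ?_ (image_subset_range _ _)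
    rintro _ ⟨t, rfl⟩
    obtain ⟨s, hs, m, rfl⟩ := exists_mem_Icc_stdCurve_eq h3 t
    exact ⟨_, hs, hper t m⟩
  have hedges : ∀ t, ∃ j < n, T t ∈ edge T j := by
    intro t
    have hn : (0 : ℤ) < n := by lia
    obtain ⟨i, hi⟩ := Int.eq_ofNat_of_zero_le (Int.emod_nonneg ⌊t⌋ hn.ne')
    have hin : i < n := by have := Int.emod_lt_of_pos ⌊t⌋ hn; lia
    refine ⟨i, hin, t + (n * (-(⌊t⌋ / n)) : ℤ), ?_, hper _ _⟩
    have h1 : (i : ℤ) = ⌊t⌋ + n * (-(⌊t⌋ / n)) := by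
      have := Int.emod_add_mul_ediv ⌊t⌋ n
      rw [← hi]
      linear_combination this
    have h2 : (i : ℝ) = ⌊t⌋ + (n * (-(⌊t⌋ / n)) : ℤ) := by exact_mod_cast h1
    have h4 := Int.floor_le t
    have h5 := Int.lt_floor_add_one t
    constructor <;> linarith
  have hpre : ∀ (v : ℂ) (a b : ℝ), v ∈ T '' Icc a b ↔
      finitePart (h.symm v) ∈ stdCurve n '' Icc a b := by
    intro v a b
    constructor
    · rintro ⟨t, ht, rfl⟩
      refine ⟨t, ht, ?_⟩
      rw [hh, Homeomorph.symm_apply_apply, finitePart_coe]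
    · rintro ⟨t, ht, htv⟩
      refine ⟨t, ht, OnePoint.coe_injective ?_⟩
      rw [hh, htv, coe_finitePart, Homeomorph.apply_symm_apply]
      refine ne_infty_of_norm_finitePart_le ?_
      rw [← htv]
      exact norm_stdCurve_le n t
  have hinj : InjOn γ.extend (Icc 0 1) := by
    intro x hx y hy hxy
    rw [Path.extend_apply γ hx, Path.extend_apply γ hy] at hxy
    exact congrArg Subtype.val (hγ hxy)
  have hvert' : ∀ j : ℕ, j < n → T ((j : ℝ) + 1) ∉ range γ := by
    intro j hj
    rcases Nat.lt_or_ge (j + 1) n with h1 | h1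
    · exact_mod_cast hvert (j + 1) h1
    · have h2 : ((j : ℝ) + 1) = n := by
        have : j + 1 = n := by lia
        exact_mod_cast this
      rw [h2, hTL]
      exact_mod_cast hvert 0 (by lia)
  choose τ hτ0 hτ1 hτE hτX using fun j : ZMod n => hcross j.val j.val_lt
  have hmemE : ∀ j : ZMod n, γ (τ j) ∈ edge T j.val := fun j =>
    (hτE j ▸ mem_singleton _ : γ (τ j) ∈ range γ ∩ edge T j.val).2
  have hmemE_iff : ∀ j : ZMod n, ∀ t : unitInterval, γ t ∈ edge T j.val ↔ t = τ j := by
    intro j t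
    constructor
    · intro ht
      have : γ t ∈ range γ ∩ edge T j.val := ⟨mem_range_self t, ht⟩
      rw [hτE j] at this
      exact hγ this
    · rintro rfl; exact hmemE j
  have hext : ∀ t : unitInterval, γ.extend t = γ t := fun t => Path.extend_apply γ t.2
  set z : ℝ → ℂ := fun t => finitePart (h.symm (γ.extend t)) with hz
  have hcont : Continuous fun t => h.symm (γ.extend t : OnePoint ℂ) :=
    h.symm.continuous.comp (OnePoint.continuous_coe.comp γ.continuous_extend)
  have hnorm : ∀ j, ‖z (τ j)‖ < 1 := by
    intro j
    obtain ⟨t, ht, htj⟩ := hmemE j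
    have h1 : z (τ j) = stdCurve n t := by
      change finitePart (h.symm (γ.extend (τ j))) = _
      rw [hext, ← htj, hh, Homeomorph.symm_apply_apply, finitePart_coe]
    rw [h1]
    refine norm_stdCurve_lt h3 ho (j.val : ℤ) ⟨lt_of_le_of_ne (by exact_mod_cast ht.1) ?_,
      lt_of_le_of_ne (by exact_mod_cast ht.2) ?_⟩
    · intro heq
      refine hvert j.val j.val_lt ⟨τ j, ?_⟩
      rw [← htj, ← heq, Int.cast_natCast]
    · intro heq
      refine hvert' j.val j.val_lt ⟨τ j, ?_⟩
      rw [← htj, heq, Int.cast_natCast]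
  have hC : CrossesEdges n z (fun j => (τ j : ℝ)) :=
    { isOpen_disc := isOpen_norm_finitePart_lt.preimage hcont
      isClosed_disc := isClosed_norm_finitePart_le.preimage hcont
      continuousOn := continuousOn_finitePart.comp hcont.continuousOn fun t ht =>
        ne_infty_of_norm_finitePart_le ht
      time_mem := fun j => ⟨hτ0 j, hτ1 j⟩
      norm_lt := hnorm
      mem_edge := fun j t ht => by
        rw [hz, ← hpre, Path.extend_apply γ ht, Int.cast_natCast]
        exact (hmemE_iff j ⟨t, ht⟩).trans Subtype.ext_iff
      flip := fun j => by
        refine ProperCrossing.flip h3 ho h (E := edge T j.val)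
          (fun v => by rw [Int.cast_natCast]; exact hpre v _ _) γ.continuous_extend hinj
          ⟨hτ0 j, hτ1 j⟩ (by rw [hext]; exact hmemE j) (hnorm j) ?_
        rw [Path.extend_range, hext]
        exact hτX j }
  have hoff : ∀ t : unitInterval, (∀ j, t ≠ τ j) → γ t ∉ range T := by
    rintro t ht ⟨s, hs⟩
    obtain ⟨j, hj, hsj⟩ := hedges s
    rw [hs] at hsj
    refine ht (j : ZMod n) ((hmemE_iff j t).1 ?_)
    rwa [ZMod.val_cast_of_lt hj]
  have hA : A ∉ range T := by
    have := hoff 0 fun j => (hτ0 j).ne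
    rwa [γ.source] at this
  have hB : B ∉ range T := by
    have := hoff 1 fun j => (hτ1 j).ne'
    rwa [γ.target] at this
  have hAB : A ≠ B := by
    intro hAB
    have : γ 0 = γ 1 := by rw [γ.source, γ.target, hAB]
    exact zero_ne_one (hγ this)
  have hlabel : ∀ p ∉ range T, HasIndex (stdCurve n) n (h.symm p)
      (stdLabel n (finitePart (h.symm p))) := fun p hp =>
    hasIndex_stdLabel h3 ho fun t ht => hp ⟨t, OnePoint.coe_injective (by
      rw [hh, ht, Homeomorph.apply_symm_apply])⟩
  obtain ⟨D₁, k₁, hAD, hD₁, hk₁⟩ := exists_isDomainWithLabel hTc hTL hrange hA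
  obtain ⟨D₂, k₂, hBD, hD₂, hk₂⟩ := exists_isDomainWithLabel hTc hTL hrange hB
  refine ⟨D₁, D₂, k₁, k₂, hAD, hBD, hD₁, hD₂, ?_⟩
  rw [abs_index_sub_eq h hh (P := h.symm A) (Q := h.symm B)
    (fun h' => hAB (OnePoint.coe_injective (h.symm.injective h')))
    (hlabel A hA) (hlabel B hB)
    (by rw [Homeomorph.apply_symm_apply]; exact hk₁)
    (by rw [Homeomorph.apply_symm_apply]; exact hk₂)]
  have := hC.stdLabel_sub h3 ho
  simpa only [hz, Path.extend_zero, Path.extend_one] using this
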